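/- **Theorem 1.3.** Let $R$ and $S$ be transitive permutation groups on finite sets $A$ and $B$ of sizes $r>1$ and $s>1$, let $\omega\in A$ and $o\in B$, and let $m\ge 3$ be an odd integer. Write $R_\omega$ for the stabiliser of $\omega$ in $R$. *Construction.* Let $\Omega$ be the disjoint union of the sets $Y_{i,j}=\{(j,i,z): z\in A\}$ for $i\in B$, $0\le j\le m-1$, and of a copy $X_m$ of $A\setminus\{\omega\}$, so $|\Omega|=mrs+r-1$. Let $H\le \mathrm{Sym}(\Omega)$ be the group generated by - for all $\sigma\in R$, $i\in B$, $0\le j\le m-1$, the permutation $(j,i,z)\mapsto(j,i,z^\sigma)$ of $Y_{i,j}$, extended by the identity on $\Omega\setminus Y_{i,j}$; - for all $\sigma\in R_\omega$, the permutation of $X_m$ induced by $\sigma$, extended by the identity on $\Omega\setminus X_m$; - for all $\tau\in S$, the permutation $(j,i,z)\mapsto(j,i^\tau,z)$, extended by the identity on $X_m$. Let $a\in\mathrm{Sym}(\Omega)$ be the following involution. - It exchanges $(0,o,z)$ with the copy of $z$ in $X_m$, for $z\ne\omega$, and fixes $(0,o,\omega)$. - It exchanges $(j,o,z)$ with $(j+1,o,z)$,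 for odd $j$ with $1\le j\le m-2$ and all $z\in A$. - It exchanges $(j,i,z)$ with $(j+1,i,z)$, for $i\ne o$, even $j$ with $0\le j\le m-3$ and all $z\in A$. - It fixes $(m-1,i,z)$, for $i\ne o$ and all $z\in A$. Put $G=\langle H,a\rangle$, and let $\Delta=\mathrm{Cos}(G,H,a)$ be the coset digraph: its vertices are the right cosets of $H$ in $G$ (permutations acting on the right), and $(Hg,Hg')$ is an arc if and only if $Hg'g^{-1}H\subseteq HaH$. The group $G$ acts on the vertices by right multiplication. *Claim.* 1. $\mathrm{Alt}(\Omega)\le G\le\mathrm{Sym}(\Omega)$, and $G$ is almost simple. 2. $\Delta$ is an undirected graph without loops. It is connected and regular of valency $rs$. The group $G$ acts faithfully on its vertices as a group of automorphisms that is transitive on its arcs. 3. For each vertex $u$ let $G_u^{[1]}$ be the subgroup of $G$ fixing every vertex at distance at most $1$ from $u$; let $G_u^{\Delta(u)}$ be the permutation group induced by the stabiliser $G_u$ on the set $\Delta(u)$ of neighbours of $u$; and for an arc $(u,v)$ put $G_{u,v}^{[1]}=G_u^{[1]}\cap G_v^{[1]}$. Then for every arc $(u,v)$ of $\Delta$: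 - $G_u^{\Delta(u)}$ is permutation isomorphic to the wreath product $R\wr S$ in its imprimitive action on $B\times A$, of degree $rs$; - $G_u^{[1]}\cong R^{s(m-1)}\times R_\omega$; - $G_{u,v}^{[1]}\cong R^{s(m-2)+1}$. Consequently, $|G_{u,v}^{[1]}|$ is not bounded by a function of the valency: for fixed $R$ and $S$ (hence fixed valency $rs$), for every $N$ there is an odd $m\ge3$ such that the graph above has $|G_{u,v}^{[1]}|>N$ for every arc $(u,v)$. -/

import Mathlib

/-! ### Permutation groups -/

/-- Two permutation groups `P` on `X` and `Q` on `Y` are permutation isomorphic: there are a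
bijection `e : X ≃ Y` and a group isomorphism `φ : P ≃* Q` with `e (g x) = (φ g) (e x)`. -/
def PermIsomorphic {X Y : Type*} (P : Subgroup (Equiv.Perm X)) (Q : Subgroup (Equiv.Perm Y)) :
    Prop :=
  ∃ (e : X ≃ Y) (φ : P ≃* Q), ∀ (g : P) (x : X),
    e ((g : Equiv.Perm X) x) = (φ g : Equiv.Perm Y) (e x)

/-- The wreath product `R ≀ S` of permutation groups `R` on `A` and `S` on `B` in its imprimitive
action on `B × A`: the blocks `{i} × A` are permuted by an element of `S`, and each block
is mapped to its image by an element of `R`, chosen independently for each block. -/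
def imprimitiveWreath {A B : Type*} (R : Subgroup (Equiv.Perm A)) (S : Subgroup (Equiv.Perm B)) :
    Subgroup (Equiv.Perm (B × A)) where
  carrier := {g | ∃ τ ∈ S, ∃ f : B → R, ∀ i z, g (i, z) = (τ i, (f i : Equiv.Perm A) z)}
  one_mem' := ⟨1, S.one_mem, 1, fun _ _ => rfl⟩
  mul_mem' := by
    rintro g h ⟨τ, hτ, f, hf⟩ ⟨τ', hτ', f', hf'⟩
    exact ⟨τ * τ', S.mul_mem hτ hτ', fun i => f (τ' i) * f' i, fun i z => by simp [hf, hf']⟩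
  inv_mem' := by
    rintro g ⟨τ, hτ, f, hf⟩
    exact ⟨τ⁻¹, S.inv_mem hτ, fun i => (f (τ⁻¹ i))⁻¹, fun i z => by
      rw [Equiv.Perm.inv_eq_iff_eq, hf]; simp⟩

/-- A group `G` is almost simple if, up to isomorphism, `T ≤ G ≤ Aut(T)` for some nonabelian
simple group `T`, where `T` is identified with the group of its inner automorphisms. -/
def IsAlmostSimple.{u} (G : Type u) [Group G] : Prop :=
  ∃ (T : Type u) (_ : Group T), IsSimpleGroup T ∧ (∃ x y : T, x * y ≠ y * x) ∧
    ∃ f : G →* MulAut T, Function.Injective f ∧ (MulAut.conj : T →* MulAut T).range ≤ f.range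

/-! ### Groups of automorphisms of graphs -/

/-- `Δ` is a `G`-arc-transitive graph: `G` is a group of automorphisms of `Δ` (it acts faithfully
on the vertices and preserves adjacency) which is transitive on the arcs of `Δ`. -/
structure IsArcTransitive (G : Type*) {V : Type*} [Group G] [MulAction G V]
    (Δ : SimpleGraph V) : Prop where
  faithful : FaithfulSMul G V
  adj_smul : ∀ (g : G) (x y : V), Δ.Adj (g • x) (g • y) ↔ Δ.Adj x y
  transitive : ∀ x y x' y' : V, Δ.Adj x y → Δ.Adj x' y' → ∃ g : G, g • x = x' ∧ g • y = y'

/-- The permutation group `G_x^{Δ(x)}` induced by the vertex stabiliser `G_x` on the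
neighbourhood `Δ(x)`. -/
def localAction (G : Type*) {V : Type*} [Group G] [MulAction G V] (Δ : SimpleGraph V) (x : V) :
    Subgroup (Equiv.Perm (Δ.neighborSet x)) where
  carrier := {p | ∃ g ∈ MulAction.stabilizer G x, ∀ v : Δ.neighborSet x, (p v : V) = g • (v : V)}
  one_mem' := ⟨1, Subgroup.one_mem _, fun v => by simp⟩
  mul_mem' := by
    rintro p q ⟨g, hg, hp⟩ ⟨h, hh, hq⟩
    exact ⟨g * h, Subgroup.mul_mem _ hg hh, fun v => by simp [hp, hq, mul_smul]⟩
  inv_mem' := by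
    rintro p ⟨g, hg, hp⟩
    refine ⟨g⁻¹, Subgroup.inv_mem _ hg, fun v => ?_⟩
    rw [eq_inv_smul_iff, ← hp]
    exact congrArg Subtype.val (p.apply_symm_apply v)

/-- The group `G_x^{[i]}` of all elements of `G` fixing every vertex at distance at most `i`
from `x`. -/
noncomputable def ballKernel (G : Type*) {V : Type*} [Group G] [MulAction G V]
    (Δ : SimpleGraph V) (i : ℕ) (x : V) : Subgroup G :=
  fixingSubgroup G {v : V | Δ.edist x v ≤ (i : ℕ∞)}

/-- The group `G_{x,y}^{[1]} = G_x^{[1]} ∩ G_y^{[1]}`. -/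
noncomputable def arcKernel (G : Type*) {V : Type*} [Group G] [MulAction G V]
    (Δ : SimpleGraph V) (x y : V) : Subgroup G :=
  ballKernel G Δ 1 x ⊓ ballKernel G Δ 1 y

/-- The coset digraph `Cos(G, H, a)`. Its vertices are the cosets `xH`, and `(xH, yH)` is an arc
if and only if `H x⁻¹ y H ⊆ H a H`, that is, `x⁻¹ y ∈ H a H`; this does not depend on
the representatives. Permutations compose from right to left in Mathlib, so that for groups of
permutations these are the right cosets `Hx` and the condition `y x⁻¹ ∈ H a H`
in the notation where permutations act on the right; the left multiplication action of `G`
below is then right multiplication. -/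
def cosetDigraph {G : Type*} [Group G] (H : Subgroup G) (a : G) : Digraph (G ⧸ H) where
  Adj u v := ∃ x y : G, (x : G ⧸ H) = u ∧ (y : G ⧸ H) = v ∧ x⁻¹ * y ∈ DoubleCoset.doubleCoset a H H

/-! ### The construction -/

namespace SpigaGraph

/-- The set `Ω`. The point `Sum.inl (j, i, z)` is the element `z` of `Y_{i,j}` (a copy of `A`),
the set `X_j` for `j < m` consists of all `Sum.inl (j, i, z)`, and the
points `Sum.inr z` form the set `X_m`, a copy of `A \ {ω}`. -/
abbrev Omega (m : ℕ) {A : Type*} (B : Type*) (ω : A) : Type _ :=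
  (Fin m × B × A) ⊕ {z : A // z ≠ ω}

/-- The permutation `x_{σ,i,j}` acting as `σ` on `Y_{i,j}` and fixing all other points. -/
def x (m : ℕ) {A B : Type*} [DecidableEq B] (ω : A) (σ : Equiv.Perm A) (i : B) (j : Fin m) :
    Equiv.Perm (Omega m B ω) :=
  Equiv.sumCongr
    (Equiv.prodCongrRight fun j' => Equiv.prodCongrRight fun i' =>
      if j' = j ∧ i' = i then σ else Equiv.refl A)
    (Equiv.refl _)

/-- The permutation `x_σ` acting on `X_m` as `σ` acts on `A \ {ω}`, where `σ` fixes `ω`,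
and fixing all other points. -/
def xLast (m : ℕ) {A : Type*} (B : Type*) (ω : A) (σ : Equiv.Perm A) (hσ : σ ω = ω) :
    Equiv.Perm (Omega m B ω) :=
  Equiv.sumCongr (Equiv.refl _)
    (σ.subtypePerm fun z => by
      rw [not_iff_not]
      exact ⟨fun h => σ.injective (h.trans hσ.symm), fun h => by rw [h, hσ]⟩)

/-- The permutation `y_τ` moving the blocks `Y_{i,j}` to `Y_{τ(i),j}` for all `j < m` and
fixing `X_m` pointwise. -/
def y (m : ℕ) {A B : Type*} (ω : A) (τ : Equiv.Perm B) : Equiv.Perm (Omega m B ω) :=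
  Equiv.sumCongr (Equiv.prodCongr (Equiv.refl _) (Equiv.prodCongr τ (Equiv.refl _))) (Equiv.refl _)

/-- The group `H`, generated by the subgroups `R(Y_{i,j})`, the subgroup `R(X_m)`, which is
the image of the point stabiliser of `ω` in `R`, and the subgroup `S(Ω)`. -/
def H (m : ℕ) {A B : Type*} [DecidableEq B] (ω : A) (R : Subgroup (Equiv.Perm A))
    (S : Subgroup (Equiv.Perm B)) : Subgroup (Equiv.Perm (Omega m B ω)) :=
  Subgroup.closure
    ({g | ∃ σ ∈ R, ∃ i j, g = x m ω σ i j} ∪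
      {g | ∃ σ ∈ R, ∃ hσ : σ ω = ω, g = xLast m B ω σ hσ} ∪
      {g | ∃ τ ∈ S, g = y m ω τ})

/-- The involution of `{0, …, m-1}` given by `0 ↔ 1`, `2 ↔ 3`, …; for odd `m` it
fixes `m-1`. -/
def pairEven {m : ℕ} (j : Fin m) : Fin m :=
  if j.val % 2 = 0 then (if h : j.val + 1 < m then ⟨j.val + 1, h⟩ else j)
  else ⟨j.val - 1, by omega⟩

/-- The involution of `{0, …, m-1}` given by `1 ↔ 2`, `3 ↔ 4`, … and fixing `0`; for odd `m`
no other point is fixed. -/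
def pairOdd {m : ℕ} (j : Fin m) : Fin m :=
  if j.val % 2 = 1 then (if h : j.val + 1 < m then ⟨j.val + 1, h⟩ else j)
  else ⟨j.val - 1, by omega⟩

/-- The map underlying `a`. It exchanges `Y_{o,0} \ {ω}` with `X_m`, fixes the point `ω` of
`Y_{o,0}`, exchanges `Y_{o,j}` with `Y_{o,j+1}` for odd `j`, exchanges `Y_{i,j}` with
`Y_{i,j+1}` for `i ≠ o` and even `j ≤ m - 3`, and fixes `Y_{i,m-1}` pointwise for `i ≠ o`. -/
def aFun {m : ℕ} (hm : 3 ≤ m) {A B : Type*} [DecidableEq A] [DecidableEq B] (ω : A) (o : B) :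
    Omega m B ω → Omega m B ω
  | Sum.inl (j, i, z) =>
    if i = o then
      if j.val = 0 then
        if h : z = ω then Sum.inl (j, i, z) else Sum.inr ⟨z, h⟩
      else Sum.inl (pairOdd j, i, z)
    else Sum.inl (pairEven j, i, z)
  | Sum.inr z => Sum.inl (⟨0, by omega⟩, o, z.val)

theorem pairEven_pairEven {m : ℕ} (j : Fin m) : pairEven (pairEven j) = j := by
  unfold pairEven
  ext
  split_ifs <;> simp_all <;> omega

theorem pairOdd_pairOdd {m : ℕ} (j : Fin m) : pairOdd (pairOdd j) = j := by
  unfold pairOdd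
  ext
  split_ifs <;> simp_all <;> omega

theorem pairOdd_ne_zero {m : ℕ} (j : Fin m) (hj : j.val ≠ 0) : (pairOdd j).val ≠ 0 := by
  unfold pairOdd
  split_ifs <;> simp_all <;> omega

theorem aFun_involutive {m : ℕ} (hm : 3 ≤ m) {A B : Type*} [DecidableEq A] [DecidableEq B]
    (ω : A) (o : B) : Function.Involutive (aFun hm ω o) := by
  rintro (⟨j, i, z⟩ | ⟨z, hz⟩)
  · by_cases hi : i = o
    · by_cases hj : j.val = 0
      · by_cases h : z = ω
        · simp [aFun, hi, hj, h]
        · have : j = ⟨0, by omega⟩ := Fin.ext hj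
          simp [aFun, hi, hj, h]
          exact this.symm
      · simp [aFun, hi, hj, pairOdd_ne_zero j hj, pairOdd_pairOdd]
    · simp [aFun, hi, pairEven_pairEven]
  · simp [aFun, hz]

/-- The involution `a` of `Ω`. -/
def a {m : ℕ} (hm : 3 ≤ m) {A B : Type*} [DecidableEq A] [DecidableEq B] (ω : A) (o : B) :
    Equiv.Perm (Omega m B ω) :=
  (aFun_involutive hm ω o).toPerm

/-- The group `G = ⟨H, a⟩`. -/
def G {m : ℕ} (hm : 3 ≤ m) {A B : Type*} [DecidableEq A] [DecidableEq B] (ω : A) (o : B)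
    (R : Subgroup (Equiv.Perm A)) (S : Subgroup (Equiv.Perm B)) :
    Subgroup (Equiv.Perm (Omega m B ω)) :=
  H m ω R S ⊔ Subgroup.closure {a hm ω o}

/-- `H` as a subgroup of `G`. -/
def HG {m : ℕ} (hm : 3 ≤ m) {A B : Type*} [DecidableEq A] [DecidableEq B] (ω : A) (o : B)
    (R : Subgroup (Equiv.Perm A)) (S : Subgroup (Equiv.Perm B)) : Subgroup (G hm ω o R S) :=
  (H m ω R S).subgroupOf (G hm ω o R S)

/-- `a` as an element of `G`. -/
def aG {m : ℕ} (hm : 3 ≤ m) {A B : Type*} [DecidableEq A] [DecidableEq B] (ω : A) (o : B)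
    (R : Subgroup (Equiv.Perm A)) (S : Subgroup (Equiv.Perm B)) : G hm ω o R S :=
  ⟨a hm ω o, Subgroup.mem_sup_right (Subgroup.subset_closure rfl)⟩

/-- The coset digraph `Cos(G, H, a)` of the construction. -/
def cos {m : ℕ} (hm : 3 ≤ m) {A B : Type*} [DecidableEq A] [DecidableEq B] (ω : A) (o : B)
    (R : Subgroup (Equiv.Perm A)) (S : Subgroup (Equiv.Perm B)) :
    Digraph (G hm ω o R S ⧸ HG hm ω o R S) :=
  cosetDigraph (HG hm ω o R S) (aG hm ω o R S)

/-- The simple graph underlying `Cos(G, H, a)`: orientations and loops are forgotten. (That there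
are no loops and that all arcs go both ways, so that nothing is lost, is part of
what has to be proved.) -/
def graph {m : ℕ} (hm : 3 ≤ m) {A B : Type*} [DecidableEq A] [DecidableEq B] (ω : A) (o : B)
    (R : Subgroup (Equiv.Perm A)) (S : Subgroup (Equiv.Perm B)) :
    SimpleGraph (G hm ω o R S ⧸ HG hm ω o R S) :=
  (cos hm ω o R S).toSimpleGraphInclusive

end SpigaGraph

/-!
The group `H` is the semidirect product of its base group, the direct product of the groups
`R(Y_{i,j})` and `R(X_m)`, by a copy of `S` permuting the blocks of each level (`mem_H_iff`).
Let `p` be the point `ω` of `Y_{o,0}`. Two facts about the involution `a` carry the argument.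

* If `σ` in `R` moves `ω`, then `σ` acting on `Y_{o,0}` and its conjugate under `a`, acting on
  `X_m` together with `p`, have supports meeting only in `p`, so their commutator is a three-cycle
  (`threeCycleRel_base`). Being joined by a three-cycle of `G` is a `G`-invariant equivalence
  relation. The class of `p` contains `Y_{o,0}` and `X_m`, it is preserved by `S` because `S` fixes
  `X_m` pointwise, and by `a` because `a` fixes `p`; so it is everything (`threeCycleRel_all`).
  Hence `G` is primitive, Jordan's theorem gives `Alt(Ω) ≤ G`, and the almost simplicity of `G`
  and the faithfulness of its action on the cosets of `H` follow.
* `H ∩ aHa` is the stabiliser of `p` in `H` (`a_conj`, `IsLevelHom.apply_base_eq_iff`). So the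
  neighbours of the vertex `H` are identified, as an `H`-set, with the level `B × A` formed by the
  blocks `Y_{i,0}`, on which `H` induces the imprimitive wreath product. The kernel of this action
  is the product of `R(X_m)` and of the `R(Y_{i,j})` with `j > 0`; those of its elements whose
  conjugates under `a` lie in it as well are the products over `Y_{o,1}` and the blocks of level at
  least two (`IsLevelHom.exists_ker_iff`, `IsLevelHom.exists_ker_conj_iff`).

The vertices and arcs of the coset graph form single `G`-orbits, so that conjugation carries this
description over to every vertex and every arc.
-/

open Equiv Equiv.Perm

/-! ### Three-cycles and almost simple permutation groups -/

/-- Two permutations whose supports meet in a single point have a three-cycle as commutator. -/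
theorem commutator_eq_swap_mul_swap {α : Type*} [DecidableEq α] {g h : Perm α} {p : α}
    (hgh : ∀ x, g x ≠ x → h x ≠ x → x = p) (hg : g p ≠ p) (hh : h p ≠ p) :
    g * h * g⁻¹ * h⁻¹ = swap p (h p) * swap p (g p) := by
  have key : ∀ x, x ≠ p → g x = x ∨ h x = x := by
    intro x hx
    by_contra! hc
    exact hx (hgh x hc.1 hc.2)
  have hgp : h (g p) = g p := (key (g p) hg).resolve_left fun h' => hg (g.injective h')
  have hhp : g (h p) = h p := (key (h p) hh).resolve_right fun h' => hh (h.injective h')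
  have hginv : ∀ x, g x = x → g⁻¹ x = x := fun x hx => by rw [Perm.inv_eq_iff_eq, hx]
  have hhinv : ∀ x, h x = x → h⁻¹ x = x := fun x hx => by rw [Perm.inv_eq_iff_eq, hx]
  have hne : g p ≠ h p := fun e => hg (g.injective (by rw [e, hhp]))
  have hg' : g⁻¹ p ≠ p := fun e => hg (by rw [Perm.inv_eq_iff_eq] at e; exact e.symm)
  have hh' : h⁻¹ p ≠ p := fun e => hh (by rw [Perm.inv_eq_iff_eq] at e; exact e.symm)
  have hg'' : h (g⁻¹ p) = g⁻¹ p := (key _ hg').resolve_left fun e => hg' (by simpa using e.symm)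
  have hh'' : g (h⁻¹ p) = h⁻¹ p := (key _ hh').resolve_right fun e => hh' (by simpa using e.symm)
  ext x
  simp only [Perm.mul_apply]
  by_cases h1 : x = p
  · subst h1
    rw [hginv _ hh'', swap_apply_left, swap_apply_of_ne_of_ne hg hne]
    simp
  by_cases h2 : x = h p
  · subst h2
    rw [swap_apply_of_ne_of_ne hh hne.symm, swap_apply_right]
    rw [show h⁻¹ (h p) = p from h.symm_apply_apply p, hg'']
    exact g.apply_symm_apply p
  by_cases h3 : x = g p
  · subst h3
    simp [hhinv _ hgp, hhp]
  rw [swap_apply_of_ne_of_ne h1 h3, swap_apply_of_ne_of_ne h1 h2]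
  rcases key x h1 with hx | hx
  · by_cases hx' : h x = x
    · simp [hhinv _ hx', hginv _ hx, hx, hx']
    · have e1 : h⁻¹ x ≠ p := fun e => h2 (by rw [← e]; simp)
      have : g (h⁻¹ x) = h⁻¹ x := (key _ e1).resolve_right fun e => hx' (by
        have := congrArg h e; simpa using this)
      rw [hginv _ this, show h (h⁻¹ x) = x from h.apply_symm_apply x, hx]
  · rw [hhinv _ hx]
    by_cases hx' : g x = x
    · simp [hginv _ hx', hx, hx']
    · have e1 : g⁻¹ x ≠ p := fun e => h3 (by rw [← e]; simp)
      have : h (g⁻¹ x) = g⁻¹ x := (key _ e1).resolve_left fun e => hx' (by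
        have := congrArg g e; simpa using this)
      rw [this]
      exact g.apply_symm_apply x

section ThreeCycles

open scoped Pointwise

variable {α : Type*} [Fintype α] [DecidableEq α]

/-- The relation on points of being equal, or mapped one to the other by a three-cycle in `G`.
It is a `G`-invariant equivalence relation. -/
def ThreeCycleRel (G : Subgroup (Perm α)) (u v : α) : Prop :=
  u = v ∨ ∃ c ∈ G, c.IsThreeCycle ∧ c u = v

theorem Equiv.Perm.IsThreeCycle.eq_or_eq_or_eq {c : Perm α} (hc : c.IsThreeCycle) {u v : α}
    (hu : c u ≠ u) (hv : c v ≠ v) : v = u ∨ v = c u ∨ v = c (c u) := by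
  have h := hc.support_eq_iff_mem_support.2 (Perm.mem_support.2 hu)
  have hv' := Perm.mem_support.2 hv
  rw [h] at hv'
  simpa using hv'

theorem Equiv.Perm.IsThreeCycle.apply_apply_apply {c : Perm α} (hc : c.IsThreeCycle) (u : α) :
    c (c (c u)) = u := by
  have : (c ^ 3) u = u := by simp [← hc.orderOf]
  simpa [pow_succ] using this

namespace ThreeCycleRel

variable {G : Subgroup (Perm α)} {u v w : α}

theorem symm (h : ThreeCycleRel G u v) : ThreeCycleRel G v u := by
  rcases h with rfl | ⟨c, hc, h3, rfl⟩
  · exact Or.inl rfl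
  · exact Or.inr ⟨c⁻¹, G.inv_mem hc, h3.inv, by simp⟩

theorem map (h : ThreeCycleRel G u v) {g : Perm α} (hg : g ∈ G) :
    ThreeCycleRel G (g u) (g v) := by
  rcases h with rfl | ⟨c, hc, h3, rfl⟩
  · exact Or.inl rfl
  · refine Or.inr ⟨g * c * g⁻¹, G.mul_mem (G.mul_mem hg hc) (G.inv_mem hg), ?_, by simp⟩
    rw [Perm.IsThreeCycle, Perm.cycleType_conj]
    exact h3

theorem trans (h : ThreeCycleRel G u v) (h' : ThreeCycleRel G v w) : ThreeCycleRel G u w := by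
  rcases h' with rfl | ⟨d, hd, h3, rfl⟩
  · exact h
  by_cases hu : d u = u
  · simpa [hu] using h.map hd
  by_cases hv : d v = v
  · rwa [hv]
  -- Here `u` and `v` both lie in the support of the three-cycle `d`.
  rcases h3.eq_or_eq_or_eq hv hu with rfl | rfl | rfl
  · exact Or.inr ⟨d, hd, h3, rfl⟩
  · exact Or.inl rfl
  · exact Or.inr ⟨d⁻¹, G.inv_mem hd, h3.inv, by simp⟩

end ThreeCycleRel

/-- If any two points are joined by a three-cycle of `G`, then `G` is primitive, and Jordan's
theorem applies. -/
theorem alternatingGroup_le_of_threeCycleRel [Nontrivial α] {G : Subgroup (Perm α)}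
    (h : ∀ u v, ThreeCycleRel G u v) : alternatingGroup α ≤ G := by
  have hex : ∀ u v, u ≠ v → ∃ c ∈ G, c.IsThreeCycle ∧ c u = v := fun u v huv =>
    (h u v).resolve_left huv
  have htrans : MulAction.IsPretransitive G α := ⟨fun u v => by
    by_cases huv : u = v
    · exact ⟨1, by simpa using huv⟩
    · obtain ⟨c, hc, -, hcu⟩ := hex u v huv
      exact ⟨⟨c, hc⟩, hcu⟩⟩
  have hprim : MulAction.IsPreprimitive G α := by
    refine { isTrivialBlock_of_isBlock := fun {D} hD => ?_ }
    by_contra hnt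
    rw [MulAction.IsTrivialBlock, not_or, Set.not_subsingleton_iff] at hnt
    obtain ⟨⟨u, hu, v, hv, huv⟩, hne⟩ := hnt
    obtain ⟨w, hw⟩ := (Set.ne_univ_iff_exists_notMem D).1 hne
    obtain ⟨c, hc, h3, hcu⟩ := hex u w fun e => hw (e ▸ hu)
    have hdisj : ∀ z ∈ D, c z ∉ D := by
      have hneq : (1 : G) • D ≠ (⟨c, hc⟩ : G) • D := by
        intro e
        rw [one_smul] at e
        exact hw (e ▸ ⟨u, hu, hcu⟩)
      have := hD hneq
      rw [one_smul] at this
      exact fun z hz hz' => Set.disjoint_left.1 this hz' ⟨z, hz, rfl⟩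
    have hcv : c v ≠ v := fun e => hdisj v hv (by rwa [e])
    have hcu' : c u ≠ u := fun e => hdisj u hu (by rwa [e])
    rcases h3.eq_or_eq_or_eq hcu' hcv with e | e | e
    · exact huv e.symm
    · exact hdisj u hu (e ▸ hv)
    · exact hdisj v hv (by rw [e, h3.apply_apply_apply]; exact hu)
  obtain ⟨u, v, huv⟩ := exists_pair_ne α
  obtain ⟨c, hc, h3, -⟩ := hex u v huv
  exact alternatingGroup_le_of_isPreprimitive_of_isThreeCycle_mem hprim h3 hc

/-- The centralizer of the alternating group in the symmetric group is trivial. -/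
theorem eq_one_of_forall_commute_alternatingGroup (hα : 4 ≤ Nat.card α) {n : Perm α}
    (hn : ∀ c ∈ alternatingGroup α, n * c = c * n) : n = 1 := by
  ext u
  by_contra hu
  change n u ≠ u at hu
  have hcard : 2 ≤ ((Finset.univ.erase u).erase (n u)).card := by
    rw [Finset.card_erase_of_mem (by simpa using hu), Finset.card_erase_of_mem (by simp),
      Finset.card_univ, ← Nat.card_eq_fintype_card]
    omega
  obtain ⟨v, hv, w, hw, hvw⟩ := Finset.one_lt_card.1 hcard
  simp only [Finset.mem_erase, Finset.mem_univ, and_true] at hv hw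
  have h := hn _ (Perm.isThreeCycle_swap_mul_swap_same hv.2.symm hw.2.symm hvw).mem_alternatingGroup
  have h' := congrArg (fun f : Perm α => f u) h
  simp only [Perm.mul_apply, swap_apply_left] at h'
  rw [swap_apply_of_ne_of_ne hw.2 hvw.symm, swap_apply_of_ne_of_ne hu hw.1.symm,
    swap_apply_of_ne_of_ne hu hv.1.symm] at h'
  exact hw.2 (n.injective h')

theorem isAlmostSimple_of_alternatingGroup_le (hα : 5 ≤ Nat.card α) {G : Subgroup (Perm α)}
    (hG : alternatingGroup α ≤ G) : IsAlmostSimple G := by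
  refine ⟨alternatingGroup α, inferInstance, alternatingGroup.isSimpleGroup hα, ?_,
    MulAut.conjNormal.comp G.subtype, ?_, ?_⟩
  · by_contra! hcomm
    have : Nontrivial (alternatingGroup α) :=
      alternatingGroup.nontrivial_of_three_le_card (by omega)
    obtain ⟨c, hc⟩ := exists_ne (1 : alternatingGroup α)
    refine hc (Subtype.ext (eq_one_of_forall_commute_alternatingGroup (by omega) fun d hd => ?_))
    exact congrArg Subtype.val (hcomm c ⟨d, hd⟩)
  · rw [injective_iff_map_eq_one]
    intro g hg
    refine Subtype.ext (eq_one_of_forall_commute_alternatingGroup (by omega) fun d hd => ?_)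
    have h := congrArg Subtype.val (DFunLike.congr_fun hg ⟨d, hd⟩)
    simp only [MonoidHom.comp_apply, MulAut.conjNormal_apply, MulAut.one_apply,
      Subgroup.subtype_apply] at h
    exact mul_inv_eq_iff_eq_mul.1 h
  · rintro _ ⟨c, rfl⟩
    refine ⟨⟨c, hG c.2⟩, ?_⟩
    ext d : 2
    simp

theorem exists_mem_alternatingGroup_apply_eq (hα : 4 ≤ Nat.card α) {u v u' v' : α}
    (h : u ≠ v) (h' : u' ≠ v') : ∃ c ∈ alternatingGroup α, c u = u' ∧ c v = v' := by
  have h1 := alternatingGroup.isMultiplyPretransitive α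
  have h2 : MulAction.IsMultiplyPretransitive (alternatingGroup α) α 2 :=
    MulAction.isMultiplyPretransitive_of_le (n := Nat.card α - 2) (by omega) (by simp)
  obtain ⟨c, hc⟩ := MulAction.is_two_pretransitive_iff.1 h2 h h'
  exact ⟨c, c.2, hc⟩

end ThreeCycles

/-! ### Coset graphs -/

section CosetGraph

variable {G : Type*} [Group G] {H : Subgroup G} {a : G}

theorem cosetDigraph_adj_coe (x y : G) :
    (cosetDigraph H a).Adj (x : G ⧸ H) (y : G ⧸ H) ↔
      x⁻¹ * y ∈ DoubleCoset.doubleCoset a H H := by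
  refine ⟨?_, fun h => ⟨x, y, rfl, rfl, h⟩⟩
  rintro ⟨x', y', hx, hy, h⟩
  rw [QuotientGroup.eq] at hx hy
  rw [DoubleCoset.mem_doubleCoset] at h ⊢
  obtain ⟨k, hk, l, hl, h⟩ := h
  refine ⟨(x'⁻¹ * x)⁻¹ * k, H.mul_mem (H.inv_mem hx) hk, l * (y'⁻¹ * y), H.mul_mem hl hy, ?_⟩
  calc x⁻¹ * y = (x'⁻¹ * x)⁻¹ * (x'⁻¹ * y') * (y'⁻¹ * y) := by group
    _ = _ := by rw [h]; group

/-- The out-neighbours of the vertex `xH` are the vertices `xhaH` with `h` in `H`. -/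
theorem cosetDigraph_adj_iff (x : G) (v : G ⧸ H) :
    (cosetDigraph H a).Adj (x : G ⧸ H) v ↔ ∃ h ∈ H, v = ((x * h * a : G) : G ⧸ H) := by
  obtain ⟨y, rfl⟩ := QuotientGroup.mk_surjective v
  rw [cosetDigraph_adj_coe, DoubleCoset.mem_doubleCoset]
  constructor
  · rintro ⟨k, hk, l, hl, h⟩
    refine ⟨k, hk, Eq.symm (QuotientGroup.eq.2 ?_)⟩
    have : (x * k * a)⁻¹ * y = l := by
      rw [inv_mul_eq_iff_eq_mul, inv_mul_eq_iff_eq_mul.1 h]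
      group
    rwa [this]
  · rintro ⟨k, hk, h⟩
    refine ⟨k, hk, (x * k * a)⁻¹ * y, QuotientGroup.eq.1 h.symm, by group⟩

theorem cosetDigraph_adj_symm (ha : a * a = 1) {u v : G ⧸ H}
    (h : (cosetDigraph H a).Adj u v) : (cosetDigraph H a).Adj v u := by
  have ha' : a⁻¹ = a := inv_eq_of_mul_eq_one_left ha
  obtain ⟨x, rfl⟩ := QuotientGroup.mk_surjective u
  obtain ⟨y, rfl⟩ := QuotientGroup.mk_surjective v
  rw [cosetDigraph_adj_coe, DoubleCoset.mem_doubleCoset] at h ⊢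
  obtain ⟨k, hk, l, hl, h⟩ := h
  refine ⟨l⁻¹, H.inv_mem hl, k⁻¹, H.inv_mem hk, ?_⟩
  have h' := congrArg (·⁻¹) h
  simp only [mul_inv_rev, inv_inv, ha'] at h'
  rw [h', mul_assoc]

theorem not_cosetDigraph_adj_self (haH : a ∉ H) (u : G ⧸ H) : ¬ (cosetDigraph H a).Adj u u := by
  obtain ⟨x, rfl⟩ := QuotientGroup.mk_surjective u
  rw [cosetDigraph_adj_coe, DoubleCoset.mem_doubleCoset]
  rintro ⟨k, hk, l, hl, h⟩
  apply haH
  have : a = k⁻¹ * l⁻¹ := by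
    rw [inv_mul_cancel, eq_comm, mul_eq_one_iff_eq_inv] at h
    rw [← h, inv_mul_cancel_left]
  rw [this]
  exact H.mul_mem (H.inv_mem hk) (H.inv_mem hl)

variable (H a) in
/-- The simple graph underlying the coset digraph `Cos(G, H, a)`. -/
def cosetGraph : SimpleGraph (G ⧸ H) := (cosetDigraph H a).toSimpleGraphInclusive

theorem cosetGraph_adj (ha : a * a = 1) (haH : a ∉ H) (u v : G ⧸ H) :
    (cosetGraph H a).Adj u v ↔ (cosetDigraph H a).Adj u v := by
  rw [cosetGraph, Digraph.toSimpleGraphInclusive, SimpleGraph.fromRel_adj]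
  refine ⟨?_, fun h => ⟨?_, Or.inl h⟩⟩
  · rintro ⟨-, h | h⟩
    · exact h
    · exact cosetDigraph_adj_symm ha h
  · rintro rfl
    exact not_cosetDigraph_adj_self haH u h

theorem cosetGraph_adj_iff (ha : a * a = 1) (haH : a ∉ H) (x : G) (v : G ⧸ H) :
    (cosetGraph H a).Adj (x : G ⧸ H) v ↔ ∃ h ∈ H, v = ((x * h * a : G) : G ⧸ H) := by
  rw [cosetGraph_adj ha haH, cosetDigraph_adj_iff]

theorem cosetGraph_exists_of_adj (ha : a * a = 1) (haH : a ∉ H) {u v : G ⧸ H}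
    (h : (cosetGraph H a).Adj u v) : ∃ x : G, u = x ∧ v = ((x * a : G) : G ⧸ H) := by
  obtain ⟨x, rfl⟩ := QuotientGroup.mk_surjective u
  obtain ⟨k, hk, rfl⟩ := (cosetGraph_adj_iff ha haH x v).1 h
  exact ⟨x * k, by rw [eq_comm, QuotientGroup.eq]; simpa using hk, rfl⟩

theorem cosetGraph_connected (ha : a * a = 1) (haH : a ∉ H)
    (hgen : Subgroup.closure ((H : Set G) ∪ {a}) = ⊤) : (cosetGraph H a).Connected := by
  have ha' : a⁻¹ = a := inv_eq_of_mul_eq_one_left ha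
  have hH : ∀ (x : G), ∀ k ∈ H, ((x * k : G) : G ⧸ H) = x := fun x k hk => by
    rw [eq_comm, QuotientGroup.eq]; simpa using hk
  have hadj : ∀ x : G, (cosetGraph H a).Adj (x : G ⧸ H) ((x * a : G) : G ⧸ H) := fun x =>
    (cosetGraph_adj_iff ha haH x _).2 ⟨1, H.one_mem, by simp⟩
  have hreach : ∀ x : G, (cosetGraph H a).Reachable ((1 : G) : G ⧸ H) x := by
    intro x
    have hx : x ∈ Subgroup.closure ((H : Set G) ∪ {a}) := hgen ▸ Subgroup.mem_top x
    induction hx using Subgroup.closure_induction_right with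
    | one => exact SimpleGraph.Reachable.refl _
    | mul_right x _ k hk ih =>
      rcases hk with hk | rfl
      · rwa [hH x k hk]
      · exact ih.trans (hadj x).reachable
    | mul_inv_cancel x _ k hk ih =>
      rcases hk with hk | rfl
      · rwa [hH x _ (H.inv_mem hk)]
      · rw [ha']
        exact ih.trans (hadj x).reachable
  refine SimpleGraph.connected_iff_exists_forall_reachable _ |>.2 ⟨((1 : G) : G ⧸ H), fun v => ?_⟩
  obtain ⟨x, rfl⟩ := QuotientGroup.mk_surjective v
  exact hreach x

theorem faithfulSMul_quotient (hcore : ∀ g : G, (∀ x : G, x⁻¹ * g * x ∈ H) → g = 1) :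
    FaithfulSMul G (G ⧸ H) := by
  refine ⟨fun {g g'} h => ?_⟩
  rw [eq_comm, ← inv_mul_eq_one]
  refine hcore _ fun x => ?_
  have h' := h (x : G ⧸ H)
  rw [MulAction.Quotient.smul_coe, MulAction.Quotient.smul_coe, eq_comm, QuotientGroup.eq] at h'
  simpa [mul_assoc] using h'

theorem cosetGraph_isArcTransitive (ha : a * a = 1) (haH : a ∉ H)
    (hcore : ∀ g : G, (∀ x : G, x⁻¹ * g * x ∈ H) → g = 1) :
    IsArcTransitive G (cosetGraph H a) where
  faithful := faithfulSMul_quotient hcore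
  adj_smul g u v := by
    obtain ⟨x, rfl⟩ := QuotientGroup.mk_surjective u
    obtain ⟨y, rfl⟩ := QuotientGroup.mk_surjective v
    rw [MulAction.Quotient.smul_coe, MulAction.Quotient.smul_coe, cosetGraph_adj ha haH,
      cosetGraph_adj ha haH, cosetDigraph_adj_coe, cosetDigraph_adj_coe]
    simp [mul_assoc]
  transitive u v u' v' h h' := by
    obtain ⟨x, rfl, rfl⟩ := cosetGraph_exists_of_adj ha haH h
    obtain ⟨x', rfl, rfl⟩ := cosetGraph_exists_of_adj ha haH h'
    refine ⟨x' * x⁻¹, ?_, ?_⟩ <;> simp [← mul_assoc]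

/-! ### The local action of a coset graph -/

theorem permIsomorphic_of_forall_mem_iff {X Y : Type*} {P : Subgroup (Perm X)}
    {Q : Subgroup (Perm Y)} (e : X ≃ Y) (h : ∀ p, p ∈ P ↔ e.permCongr p ∈ Q) :
    PermIsomorphic P Q := by
  have hmap : P.map (e.permCongrHom : Perm X →* Perm Y) = Q := by
    ext q
    constructor
    · rintro ⟨p, hp, rfl⟩
      exact (h p).1 hp
    · intro hq
      refine ⟨e.permCongr.symm q, (h _).2 ?_, e.permCongr.apply_symm_apply q⟩
      rwa [e.permCongr.apply_symm_apply]
  subst hmap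
  refine ⟨e, e.permCongrHom.subgroupMap P, fun g z => ?_⟩
  change e ((g : Perm X) z) = e.permCongr (g : Perm X) (e z)
  simp

variable {X : Type*} {ψ : H →* Perm X} {x₀ : X}

/-- The points of a transitive `H`-set in which `H ∩ aHa⁻¹` is a point stabiliser correspond
equivariantly to the neighbours of the vertex `xH` of the coset graph. -/
theorem exists_equiv_neighborSet (ha : a * a = 1) (haH : a ∉ H)
    (htrans : ∀ q, ∃ h, ψ h x₀ = q)
    (hstab : ∀ h : H, ψ h x₀ = x₀ ↔ a⁻¹ * h * a ∈ H) (x : G) :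
    ∃ e : X ≃ (cosetGraph H a).neighborSet (x : G ⧸ H),
      ∀ h : H, (e (ψ h x₀) : G ⧸ H) = ((x * h * a : G) : G ⧸ H) := by
  choose k hk using htrans
  have key : ∀ h h' : H, ψ h x₀ = ψ h' x₀ ↔
      ((x * h * a : G) : G ⧸ H) = ((x * h' * a : G) : G ⧸ H) := by
    intro h h'
    rw [QuotientGroup.eq, eq_comm, ← Perm.inv_eq_iff_eq, ← map_inv, ← Perm.mul_apply,
      ← map_mul, hstab]
    simp [mul_assoc]
  let f : X → (cosetGraph H a).neighborSet (x : G ⧸ H) := fun q =>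
    ⟨((x * k q * a : G) : G ⧸ H), (cosetGraph_adj_iff ha haH x _).2 ⟨k q, (k q).2, rfl⟩⟩
  have hf : ∀ h : H, (f (ψ h x₀) : G ⧸ H) = ((x * h * a : G) : G ⧸ H) := fun h =>
    (key _ _).1 (hk _)
  refine ⟨Equiv.ofBijective f ⟨fun q q' h => ?_, fun v => ?_⟩, hf⟩
  · rw [← hk q, ← hk q']
    exact (key _ _).2 (congrArg Subtype.val h)
  · obtain ⟨h, hh, hv⟩ := (cosetGraph_adj_iff ha haH x _).1 v.2
    exact ⟨ψ ⟨h, hh⟩ x₀, Subtype.ext ((hf _).trans hv.symm)⟩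

theorem mem_stabilizer_coe_iff (g x : G) :
    g ∈ MulAction.stabilizer G (x : G ⧸ H) ↔ x⁻¹ * g * x ∈ H := by
  rw [MulAction.mem_stabilizer_iff, MulAction.Quotient.smul_coe, eq_comm, QuotientGroup.eq]
  simp [mul_assoc]

/-- At every vertex `u` the valency and the local action `G_u^{Δ(u)}` can be read off from a
transitive `H`-set in which `H ∩ aHa⁻¹` is a point stabiliser. -/
theorem cosetGraph_local (ha : a * a = 1) (haH : a ∉ H)
    (htrans : ∀ q, ∃ h, ψ h x₀ = q)
    (hstab : ∀ h : H, ψ h x₀ = x₀ ↔ a⁻¹ * h * a ∈ H) (u : G ⧸ H) :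
    ((cosetGraph H a).neighborSet u).ncard = Nat.card X ∧
      PermIsomorphic (localAction G (cosetGraph H a) u) ψ.range := by
  obtain ⟨x, rfl⟩ := QuotientGroup.mk_surjective u
  obtain ⟨e, he⟩ := exists_equiv_neighborSet ha haH htrans hstab x
  have hequi : ∀ (h : H) (q : X), (e (ψ h q) : G ⧸ H) = (x * h * x⁻¹) • (e q : G ⧸ H) := by
    intro h q
    obtain ⟨k, rfl⟩ := htrans q
    rw [← Perm.mul_apply, ← map_mul, he, he, MulAction.Quotient.smul_coe]
    simp [mul_assoc]
  refine ⟨(Nat.card_congr e).symm, permIsomorphic_of_forall_mem_iff e.symm fun p => ?_⟩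
  constructor
  · rintro ⟨g, hg, hp⟩
    refine ⟨⟨x⁻¹ * g * x, (mem_stabilizer_coe_iff g x).1 hg⟩, ?_⟩
    ext q
    rw [Equiv.permCongr_apply, Equiv.symm_symm, Equiv.eq_symm_apply]
    refine Subtype.ext ((hequi _ _).trans ((?_ : _ = g • _).trans (hp (e q)).symm))
    simp [mul_assoc]
  · rintro ⟨h, hh⟩
    refine ⟨x * h * x⁻¹, (mem_stabilizer_coe_iff _ x).2 (by simp [mul_assoc]), fun v => ?_⟩
    have := hequi h (e.symm v)
    rw [hh] at this
    simpa using this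

/-- The group `G_u^{[1]}` at the vertex `u = xH` is the conjugate by `x` of the kernel of the
action of `H` on the neighbours of `H`. -/
theorem mem_ballKernel_one_iff (ha : a * a = 1) (haH : a ∉ H)
    (htrans : ∀ q, ∃ h, ψ h x₀ = q)
    (hstab : ∀ h : H, ψ h x₀ = x₀ ↔ a⁻¹ * h * a ∈ H) (x g : G) :
    g ∈ ballKernel G (cosetGraph H a) 1 (x : G ⧸ H) ↔ ∃ h : H, ψ h = 1 ∧ x⁻¹ * g * x = h := by
  have hmem : g ∈ ballKernel G (cosetGraph H a) 1 (x : G ⧸ H) ↔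
      g ∈ MulAction.stabilizer G (x : G ⧸ H) ∧
        ∀ k ∈ H, g ∈ MulAction.stabilizer G ((x * k * a : G) : G ⧸ H) := by
    rw [ballKernel, mem_fixingSubgroup_iff]
    simp only [Set.mem_ofPred_eq, Nat.cast_one, SimpleGraph.edist_le_one_iff_adj_or_eq,
      MulAction.mem_stabilizer_iff]
    constructor
    · exact fun h => ⟨h _ (Or.inr rfl), fun k hk =>
        h _ (Or.inl ((cosetGraph_adj_iff ha haH x _).2 ⟨k, hk, rfl⟩))⟩
    · rintro ⟨h1, h2⟩ v (hv | rfl)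
      · obtain ⟨k, hk, rfl⟩ := (cosetGraph_adj_iff ha haH x v).1 hv
        exact h2 k hk
      · exact h1
  rw [hmem]
  simp only [mem_stabilizer_coe_iff]
  have hconj : ∀ h k : H, a⁻¹ * (k⁻¹ * h * k) * a ∈ H ↔ ψ h (ψ k x₀) = ψ k x₀ := by
    intro h k
    have := hstab (k⁻¹ * h * k)
    rw [map_mul, map_mul, map_inv, Perm.mul_apply, Perm.mul_apply, Perm.inv_eq_iff_eq] at this
    rw [this]
    simp
  constructor
  · rintro ⟨h1, h2⟩
    refine ⟨⟨_, h1⟩, ?_, rfl⟩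
    ext q
    obtain ⟨k, rfl⟩ := htrans q
    refine (hconj _ _).1 ?_
    simpa [mul_assoc] using h2 k k.2
  · rintro ⟨h, hψ, he⟩
    refine ⟨he ▸ h.2, fun k hk => ?_⟩
    have := (hconj h ⟨k, hk⟩).2 (by simp [hψ])
    rw [← he] at this
    simpa [mul_assoc] using this

theorem mem_arcKernel_iff (ha : a * a = 1) (haH : a ∉ H)
    (htrans : ∀ q, ∃ h, ψ h x₀ = q)
    (hstab : ∀ h : H, ψ h x₀ = x₀ ↔ a⁻¹ * h * a ∈ H) (x g : G) :
    g ∈ arcKernel G (cosetGraph H a) (x : G ⧸ H) ((x * a : G) : G ⧸ H) ↔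
      (∃ h : H, ψ h = 1 ∧ x⁻¹ * g * x = h) ∧
        ∃ h : H, ψ h = 1 ∧ a⁻¹ * (x⁻¹ * g * x) * a = h := by
  rw [arcKernel, Subgroup.mem_inf, mem_ballKernel_one_iff ha haH htrans hstab,
    mem_ballKernel_one_iff ha haH htrans hstab]
  simp [mul_assoc]

end CosetGraph

/-! ### Permutation representations and powers of a group -/

theorem exists_monoidHom_perm {M X Ω : Type*} [Group M] [MulAction M Ω] {ι : X → Ω}
    (hι : Function.Injective ι) (h : ∀ (g : M) (q : X), ∃ q', g • ι q = ι q') :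
    ∃ ψ : M →* Perm X, ∀ g q, g • ι q = ι (ψ g q) := by
  choose f hf using h
  let _ : MulAction M X :=
    { smul := f
      one_smul := fun q => hι (by
        change ι (f 1 q) = _
        rw [← hf, one_smul])
      mul_smul := fun g g' q => hι (by
        change ι (f (g * g') q) = ι (f g (f g' q))
        rw [← hf, ← hf, ← hf, mul_smul]) }
  exact ⟨MulAction.toPermHom M X, hf⟩

theorem nonempty_mulEquiv_of_forall_mem_iff {M N : Type*} [Group M] [Group N] (φ : M →* N)
    (hφ : Function.Injective φ) (K : Subgroup N) (h : ∀ n, n ∈ K ↔ ∃ p, φ p = n) :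
    Nonempty (K ≃* M) := by
  have : φ.range = K := by
    ext n
    exact (h n).symm
  subst this
  exact ⟨(MonoidHom.ofInjective hφ).symm⟩

/-- Extension by one along an injection identifies functions on its domain with the functions
that are trivial off its range. -/
theorem exists_extendByOne_eq_iff {ι η M : Type*} [MulOneClass M] {s : ι → η}
    (hs : Function.Injective s) {P : η → Prop} (hP : ∀ q, P q ↔ ∃ k, s k = q) (f : η → M) :
    (∃ g, Function.ExtendByOne.hom M s g = f) ↔ ∀ q, ¬ P q → f q = 1 := by
  constructor
  · rintro ⟨g, rfl⟩ q hq
    exact Function.extend_apply' _ _ _ fun h => hq ((hP q).2 h)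
  · intro h
    refine ⟨f ∘ s, funext fun q => ?_⟩
    by_cases hq : P q
    · obtain ⟨k, rfl⟩ := (hP q).1 hq
      exact hs.extend_apply _ _ _
    · rw [h q hq]
      exact Function.extend_apply' _ _ _ fun h => hq ((hP q).2 h)

theorem extendByOne_injective {ι η M : Type*} [MulOneClass M] {s : ι → η}
    (hs : Function.Injective s) : Function.Injective (Function.ExtendByOne.hom M s) := by
  intro g g' h
  funext k
  have := congrFun h (s k)
  simpa [Function.ExtendByOne.hom, hs.extend_apply] using this

theorem Finset.exists_fin_enumeration {η : Type*} (P : Finset η) {n : ℕ} (hn : P.card = n) :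
    ∃ s : Fin n → η, Function.Injective s ∧ ∀ q, q ∈ P ↔ ∃ k, s k = q := by
  refine ⟨fun k => (P.equivFinOfCardEq hn).symm k,
    Subtype.val_injective.comp (Equiv.injective _), fun q => ⟨fun hq => ?_, ?_⟩⟩
  · exact ⟨P.equivFinOfCardEq hn ⟨q, hq⟩, by simp⟩
  · rintro ⟨k, rfl⟩
    exact ((P.equivFinOfCardEq hn).symm k).2

namespace SpigaGraph

/-! ### The structure of `H` -/

section Structure

variable {m : ℕ} {A B : Type*} {ω : A} {R : Subgroup (Perm A)} {S : Subgroup (Perm B)}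

variable (m B ω R) in
/-- The base group of `H`: the direct product of the groups `R(Y_{i,j})`, indexed by the pairs
`(j, i)`, and of `R(X_m)`. -/
def blockPerm : ((Fin m × B → R) × MulAction.stabilizer R ω) →* Perm (Omega m B ω) where
  toFun p := Equiv.sumCongr
    (Equiv.prodCongrRight fun j => Equiv.prodCongrRight fun i => (p.1 (j, i) : Perm A))
    ((p.2 : Perm A).subtypePerm fun z => by
      have h : (p.2 : Perm A) ω = ω := p.2.2
      rw [not_iff_not]
      exact ⟨fun h' => (p.2 : Perm A).injective (h'.trans h.symm), fun h' => by rw [h', h]⟩)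
  map_one' := by
    ext (⟨j, i, z⟩ | z) <;> rfl
  map_mul' p p' := by
    ext (⟨j, i, z⟩ | z) <;> rfl

theorem stabilizer_apply (ρ : MulAction.stabilizer R ω) : (ρ : Perm A) ω = ω := ρ.2

theorem stabilizer_apply_ne (ρ : MulAction.stabilizer R ω) {z : A} (hz : z ≠ ω) :
    (ρ : Perm A) z ≠ ω :=
  fun h => hz ((ρ : Perm A).injective (h.trans (stabilizer_apply ρ).symm))

@[simp] theorem blockPerm_inl (p : (Fin m × B → R) × MulAction.stabilizer R ω)
    (j : Fin m) (i : B) (z : A) :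
    blockPerm m B ω R p (Sum.inl (j, i, z)) = Sum.inl (j, i, (p.1 (j, i) : Perm A) z) := rfl

@[simp] theorem blockPerm_inr (p : (Fin m × B → R) × MulAction.stabilizer R ω)
    (z : {z : A // z ≠ ω}) :
    blockPerm m B ω R p (Sum.inr z) =
      Sum.inr ⟨(p.2 : Perm A) z, stabilizer_apply_ne p.2 z.2⟩ := rfl

@[simp] theorem y_inl (τ : Perm B) (j : Fin m) (i : B) (z : A) :
    y m ω τ (Sum.inl (j, i, z)) = Sum.inl (j, τ i, z) := rfl

@[simp] theorem y_inr (τ : Perm B) (z : {z : A // z ≠ ω}) :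
    y m ω τ (Sum.inr z) = Sum.inr z := rfl

theorem y_one : y m ω (1 : Perm B) = 1 := by
  ext (⟨j, i, z⟩ | z) <;> rfl

theorem y_mul (τ τ' : Perm B) : y m ω (τ * τ') = y m ω τ * y m ω τ' := by
  ext (⟨j, i, z⟩ | z) <;> rfl

theorem blockPerm_mul_y (f : Fin m × B → R) (ρ : MulAction.stabilizer R ω) (τ : Perm B) :
    blockPerm m B ω R (f, ρ) * y m ω τ =
      y m ω τ * blockPerm m B ω R (fun q => f (q.1, τ q.2), ρ) := by
  ext (⟨j, i, z⟩ | z) <;> rfl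

theorem blockPerm_injective : Function.Injective (blockPerm m B ω R) := by
  rintro ⟨f, ρ⟩ ⟨f', ρ'⟩ h
  have h' : ∀ w, blockPerm m B ω R (f, ρ) w = blockPerm m B ω R (f', ρ') w := fun w => by rw [h]
  refine Prod.ext (funext fun ⟨j, i⟩ => Subtype.ext (Equiv.ext fun z => ?_))
    (Subtype.ext (Subtype.ext (Equiv.ext fun z => ?_)))
  · simpa using h' (Sum.inl (j, i, z))
  · by_cases hz : z = ω
    · subst hz
      exact (stabilizer_apply ρ).trans (stabilizer_apply ρ').symm
    · simpa using h' (Sum.inr ⟨z, hz⟩)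

variable [DecidableEq B]

theorem x_mem_H {σ : Perm A} (hσ : σ ∈ R) (i : B) (j : Fin m) : x m ω σ i j ∈ H m ω R S :=
  Subgroup.subset_closure (Or.inl (Or.inl ⟨σ, hσ, i, j, rfl⟩))

theorem y_mem_H {τ : Perm B} (hτ : τ ∈ S) : y m ω τ ∈ H m ω R S :=
  Subgroup.subset_closure (Or.inr ⟨τ, hτ, rfl⟩)

theorem x_eq_blockPerm (σ : R) (i : B) (j : Fin m) :
    x m ω (σ : Perm A) i j = blockPerm m B ω R (Pi.mulSingle (j, i) σ, 1) := by
  ext (⟨j', i', z⟩ | z) : 1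
  · by_cases h : j' = j ∧ i' = i
    · obtain ⟨rfl, rfl⟩ := h
      simp [x]
    · simp [x, h]
  · rfl

theorem blockPerm_mem_H [Finite B] (p : (Fin m × B → R) × MulAction.stabilizer R ω) :
    blockPerm m B ω R p ∈ H m ω R S := by
  obtain ⟨f, ρ⟩ := p
  have h1 : blockPerm m B ω R (f, 1) ∈ H m ω R S := by
    have : f ∈ (H m ω R S).comap ((blockPerm m B ω R).comp (MonoidHom.inl _ _)) := by
      refine Subgroup.pi_mem_of_mulSingle_mem f fun q => ?_
      have := x_mem_H (S := S) (ω := ω) (f q).2 q.2 q.1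
      rwa [x_eq_blockPerm] at this
    exact this
  have h2 : blockPerm m B ω R (1, ρ) ∈ H m ω R S :=
    Subgroup.subset_closure (Or.inl (Or.inr ⟨ρ, ρ.1.2, ρ.2, by
      ext (⟨j, i, z⟩ | z) <;> rfl⟩))
  have := (H m ω R S).mul_mem h1 h2
  rwa [← map_mul, Prod.mk_mul_mk, mul_one, one_mul] at this

/-- The normal form of the elements of `H`, which is a semidirect product of its base group
with a copy of `S`. -/
theorem mem_H_iff [Finite B] {h : Perm (Omega m B ω)} :
    h ∈ H m ω R S ↔ ∃ τ ∈ S, ∃ f ρ, h = y m ω τ * blockPerm m B ω R (f, ρ) := by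
  constructor
  · intro hh
    induction hh using Subgroup.closure_induction_right with
    | one => exact ⟨1, S.one_mem, 1, 1, by rw [y_one, ← Prod.one_eq_mk, map_one, one_mul]⟩
    | mul_right g _ k hk ih =>
      obtain ⟨τ, hτ, f, ρ, rfl⟩ := ih
      rcases hk with (⟨σ, hσ, i, j, rfl⟩ | ⟨σ, hσ, hω, rfl⟩) | ⟨τ', hτ', rfl⟩
      · refine ⟨τ, hτ, f * Pi.mulSingle (j, i) ⟨σ, hσ⟩, ρ, ?_⟩
        rw [x_eq_blockPerm ⟨σ, hσ⟩, mul_assoc, ← map_mul, Prod.mk_mul_mk, mul_one]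
      · refine ⟨τ, hτ, f, ρ * ⟨⟨σ, hσ⟩, hω⟩, ?_⟩
        ext (⟨j, i, z⟩ | z) <;> rfl
      · refine ⟨τ * τ', S.mul_mem hτ hτ', fun q => f (q.1, τ' q.2), ρ, ?_⟩
        rw [mul_assoc, blockPerm_mul_y, ← mul_assoc, ← y_mul]
    | mul_inv_cancel g _ k hk ih =>
      obtain ⟨τ, hτ, f, ρ, rfl⟩ := ih
      rcases hk with (⟨σ, hσ, i, j, rfl⟩ | ⟨σ, hσ, hω, rfl⟩) | ⟨τ', hτ', rfl⟩
      · refine ⟨τ, hτ, f * (Pi.mulSingle (j, i) ⟨σ, hσ⟩)⁻¹, ρ, ?_⟩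
        rw [x_eq_blockPerm ⟨σ, hσ⟩, mul_assoc, ← map_inv, ← map_mul, Prod.inv_mk, Prod.mk_mul_mk,
          inv_one, mul_one]
      · refine ⟨τ, hτ, f, ρ * ⟨⟨σ, hσ⟩, hω⟩⁻¹, ?_⟩
        rw [mul_inv_eq_iff_eq_mul]
        have : xLast m B ω σ hω = blockPerm m B ω R (1, ⟨⟨σ, hσ⟩, hω⟩) := by
          ext (⟨j, i, z⟩ | z) <;> rfl
        rw [this, mul_assoc, ← map_mul, Prod.mk_mul_mk, mul_one, inv_mul_cancel_right]
      · refine ⟨τ * τ'⁻¹, S.mul_mem hτ (S.inv_mem hτ'), fun q => f (q.1, τ'⁻¹ q.2), ρ, ?_⟩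
        have : (y m ω τ')⁻¹ = y m ω τ'⁻¹ := by
          rw [inv_eq_iff_mul_eq_one, ← y_mul, mul_inv_cancel, y_one]
        rw [this, mul_assoc, blockPerm_mul_y, ← mul_assoc, ← y_mul]
  · rintro ⟨τ, hτ, f, ρ, rfl⟩
    exact (H m ω R S).mul_mem (y_mem_H hτ) (blockPerm_mem_H _)

end Structure

/-! ### The involution -/

section Involution

variable {m : ℕ} (hm : 3 ≤ m) {A B : Type*} [DecidableEq A] [DecidableEq B] {ω : A} {o : B}

theorem a_apply (w : Omega m B ω) : a hm ω o w = aFun hm ω o w := rfl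

theorem a_apply_inr (z : {z : A // z ≠ ω}) :
    a hm ω o (Sum.inr z) = Sum.inl (⟨0, by omega⟩, o, z.val) := rfl

theorem a_apply_base : a hm ω o (Sum.inl (⟨0, by omega⟩, o, ω)) = Sum.inl (⟨0, by omega⟩, o, ω) := by
  simp [a_apply, aFun]

theorem a_apply_inl_zero {z : A} (hz : z ≠ ω) :
    a hm ω o (Sum.inl (⟨0, by omega⟩, o, z)) = Sum.inr ⟨z, hz⟩ := by
  simp [a_apply, aFun, hz]

theorem a_apply_inl_of_eq {j : Fin m} (hj : j.val ≠ 0) (z : A) :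
    a hm ω o (Sum.inl (j, o, z)) = Sum.inl (pairOdd j, o, z) := by
  simp [a_apply, aFun, hj]

theorem a_apply_inl_of_ne (j : Fin m) {i : B} (hi : i ≠ o) (z : A) :
    a hm ω o (Sum.inl (j, i, z)) = Sum.inl (pairEven j, i, z) := by
  simp [a_apply, aFun, hi]

theorem a_mul_a : a hm ω o * a hm ω o = 1 := by
  ext w : 1
  exact aFun_involutive hm ω o w

/-- The block interchanged by `a` with the block `Y_{i,j}`, where `q = (j, i)`. The value at
`(0, o)`, whose block is not mapped to a block, is `(0, o)`. -/
def partner (o : B) (q : Fin m × B) : Fin m × B :=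
  if q.2 = o then (pairOdd q.1, q.2) else (pairEven q.1, q.2)

variable {R : Subgroup (Perm A)} {S : Subgroup (Perm B)}

/-- Conjugation by `a` preserves the stabiliser in `H` of the point `ω` of `Y_{o,0}`: it permutes
the direct factors `R(Y_{i,j})` with `(j, i) ≠ (0, o)`, it interchanges the stabiliser of that
point in `R(Y_{o,0})` with `R(X_m)`, and it centralises the stabiliser of `o` in `S`. -/
theorem a_conj {τ : Perm B} (hτ : τ o = o) (f : Fin m × B → R)
    (ρ : MulAction.stabilizer R ω)
    (hf : f (⟨0, by omega⟩, o) ∈ MulAction.stabilizer R ω) :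
    a hm ω o * (y m ω τ * blockPerm m B ω R (f, ρ)) * a hm ω o =
      y m ω τ * blockPerm m B ω R
        (fun q => if q = (⟨0, by omega⟩, o) then (ρ : R) else f (partner o q), ⟨_, hf⟩) := by
  have ha' : (a hm ω o)⁻¹ = a hm ω o := inv_eq_of_mul_eq_one_left (a_mul_a hm)
  have hzero : 0 < m := by omega
  rw [← eq_mul_inv_iff_mul_eq, ha']
  have hτi : ∀ {i}, i ≠ o → τ i ≠ o := fun hi h => hi (τ.injective (h.trans hτ.symm))
  have hfω : (f (⟨0, by omega⟩, o) : Perm A) ω = ω := hf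
  ext (⟨j, i, z⟩ | z) : 1
  · by_cases hi : i = o
    · subst hi
      by_cases hj : j.val = 0
      · obtain rfl : j = ⟨0, hzero⟩ := Fin.ext hj
        by_cases hz : z = ω
        · subst hz
          simp [a_apply_base, hτ, hfω, stabilizer_apply ρ]
        · have hz' : (f (⟨0, by omega⟩, i) : Perm A) z ≠ ω :=
            stabilizer_apply_ne ⟨_, hf⟩ hz
          simp [a_apply_inl_zero, hτ, hz, hz']
      · have hj' := pairOdd_ne_zero j hj
        have hne : pairOdd j ≠ ⟨0, by omega⟩ := fun e => hj' (by rw [e])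
        simp [a_apply_inl_of_eq, hτ, hj, hne, partner, pairOdd_pairOdd]
    · simp [a_apply_inl_of_ne, hi, hτi hi, partner, pairEven_pairEven]
  · simp [a_apply_inr, hτ]

end Involution

/-! ### The alternating group is contained in `G` -/

section Alternating

variable {m : ℕ} (hm : 3 ≤ m) {A B : Type*} [DecidableEq A] [DecidableEq B] {ω : A} {o : B}
  {R : Subgroup (Perm A)} {S : Subgroup (Perm B)}

theorem H_le_G : H m ω R S ≤ G hm ω o R S := le_sup_left

theorem a_mem_G : a hm ω o ∈ G hm ω o R S := (aG hm ω o R S).2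

variable [Fintype A] [Fintype B]

/-- For `σ` in `R` moving `ω`, the supports of `σ` acting on `Y_{o,0}` and of its conjugate
under `a` meet only in the point `ω` of `Y_{o,0}`, so that their commutator is a three-cycle. -/
theorem threeCycleRel_base {z : A} (hz : z ≠ ω) {σ : Perm A} (hσ : σ ∈ R) (hσz : σ ω = z) :
    ThreeCycleRel (G hm ω o R S) (Sum.inl (⟨0, by omega⟩, o, ω)) (Sum.inl (⟨0, by omega⟩, o, z)) ∧
    ThreeCycleRel (G hm ω o R S) (Sum.inl (⟨0, by omega⟩, o, ω)) (Sum.inr ⟨z, hz⟩) := by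
  have hzero : 0 < m := by omega
  set p : Omega m B ω := Sum.inl (⟨0, hzero⟩, o, ω) with hp
  set g : Perm (Omega m B ω) := x m ω σ o ⟨0, hzero⟩ with hg
  have ha' : (a hm ω o)⁻¹ = a hm ω o := inv_eq_of_mul_eq_one_left (a_mul_a hm)
  have hgG : g ∈ G hm ω o R S := H_le_G hm (x_mem_H hσ _ _)
  have hgp : g p = Sum.inl (⟨0, hzero⟩, o, z) := by simp [hg, hp, x, hσz]
  have hap : a hm ω o p = p := a_apply_base hm
  set h : Perm (Omega m B ω) := a hm ω o * g * a hm ω o with hh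
  have hhG : h ∈ G hm ω o R S :=
    Subgroup.mul_mem _ (Subgroup.mul_mem _ (a_mem_G hm) hgG) (a_mem_G hm)
  have hhp : h p = Sum.inr ⟨z, hz⟩ := by
    simp only [hh, Perm.mul_apply, hap, hgp]
    exact a_apply_inl_zero hm hz
  have hsupp : ∀ w, g w ≠ w → ∃ u, w = Sum.inl (⟨0, hzero⟩, o, u) := by
    rintro (⟨j, i, u⟩ | u) hw
    · by_cases hc : j = ⟨0, hzero⟩ ∧ i = o
      · exact ⟨u, by rw [hc.1, hc.2]⟩
      · exact absurd (by simp [hg, x, hc]) hw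
    · exact absurd rfl hw
  have hinter : ∀ w, g w ≠ w → h w ≠ w → w = p := by
    intro w hw hw'
    obtain ⟨u, rfl⟩ := hsupp w hw
    by_contra hne
    have hu : u ≠ ω := fun e => hne (by rw [e])
    apply hw'
    simp only [hh, Perm.mul_apply]
    rw [a_apply_inl_zero hm hu]
    exact a_apply_inr hm _
  have hgp' : g p ≠ p := by rw [hgp, hp]; simpa using hz
  have hhp' : h p ≠ p := by rw [hhp, hp]; simp
  have hne : h p ≠ g p := by rw [hhp, hgp]; simp
  have hcomm := commutator_eq_swap_mul_swap hinter hgp' hhp'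
  have hcG : swap p (h p) * swap p (g p) ∈ G hm ω o R S := by
    rw [← hcomm]
    exact Subgroup.mul_mem _ (Subgroup.mul_mem _ (Subgroup.mul_mem _ hgG hhG)
      (Subgroup.inv_mem _ hgG)) (Subgroup.inv_mem _ hhG)
  have h3 := Perm.isThreeCycle_swap_mul_swap_same hhp'.symm hgp'.symm hne
  constructor
  · refine Or.inr ⟨_, hcG, h3, ?_⟩
    rw [Perm.mul_apply, swap_apply_left, swap_apply_of_ne_of_ne hgp' hne.symm, hgp]
  · refine Or.inr ⟨_, Subgroup.inv_mem _ hcG, h3.inv, ?_⟩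
    rw [Perm.inv_eq_iff_eq, ← hhp, Perm.mul_apply, swap_apply_of_ne_of_ne hhp' hne,
      swap_apply_right]

/-- All points are joined to the point `ω` of `Y_{o,0}`: this holds on `Y_{o,0}` and on `X_m`,
the relation is invariant under `S`, which is transitive on the blocks of each level, and `a`
links each level to the next one, on the block of `o` or on the other blocks. -/
theorem threeCycleRel_all [Nontrivial A] [Nontrivial B] (hR : MulAction.IsPretransitive R A)
    (hS : MulAction.IsPretransitive S B) (w : Omega m B ω) :
    ThreeCycleRel (G hm ω o R S) (Sum.inl (⟨0, by omega⟩, o, ω)) w := by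
  have hzero : 0 < m := by omega
  have hbase : ∀ z, ThreeCycleRel (G hm ω o R S) (Sum.inl (⟨0, hzero⟩, o, ω))
      (Sum.inl (⟨0, hzero⟩, o, z)) := by
    intro z
    by_cases hz : z = ω
    · rw [hz]
      exact Or.inl rfl
    · obtain ⟨σ, hσ⟩ := MulAction.exists_smul_eq R ω z
      exact (threeCycleRel_base hm hz σ.2 hσ).1
  have hlast : ∀ z, ThreeCycleRel (G hm ω o R S) (Sum.inl (⟨0, hzero⟩, o, ω)) (Sum.inr z) := by
    intro z
    obtain ⟨σ, hσ⟩ := MulAction.exists_smul_eq R ω z.1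
    exact (threeCycleRel_base hm z.2 σ.2 hσ).2
  obtain ⟨z₀, hz₀⟩ := exists_ne ω
  -- The elements of `S` fix `X_m` pointwise, and `X_m` is not empty.
  have hy : ∀ {w : Omega m B ω} (τ : S),
      ThreeCycleRel (G hm ω o R S) (Sum.inl (⟨0, hzero⟩, o, ω)) w →
      ThreeCycleRel (G hm ω o R S) (Sum.inl (⟨0, hzero⟩, o, ω)) (y m ω τ w) := by
    intro w τ hw
    have := ((hlast ⟨z₀, hz₀⟩).symm.trans hw).map (H_le_G hm (y_mem_H τ.2))
    exact (hlast ⟨z₀, hz₀⟩).trans this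
  have ha : ∀ {w : Omega m B ω},
      ThreeCycleRel (G hm ω o R S) (Sum.inl (⟨0, hzero⟩, o, ω)) w →
      ThreeCycleRel (G hm ω o R S) (Sum.inl (⟨0, hzero⟩, o, ω)) (a hm ω o w) := by
    intro w hw
    have := hw.map (a_mem_G hm)
    rwa [a_apply_base] at this
  have hlevel : ∀ (j : Fin m) (i₀ : B), (∀ z, ThreeCycleRel (G hm ω o R S)
      (Sum.inl (⟨0, hzero⟩, o, ω)) (Sum.inl (j, i₀, z))) → ∀ i z,
      ThreeCycleRel (G hm ω o R S) (Sum.inl (⟨0, hzero⟩, o, ω)) (Sum.inl (j, i, z)) := by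
    intro j i₀ h i z
    obtain ⟨τ, hτ⟩ := MulAction.exists_smul_eq S i₀ i
    have := hy τ (h z)
    rwa [y_inl, show (τ : Perm B) i₀ = i from hτ] at this
  have hall : ∀ (k : ℕ) (hk : k < m) i z,
      ThreeCycleRel (G hm ω o R S) (Sum.inl (⟨0, hzero⟩, o, ω)) (Sum.inl (⟨k, hk⟩, i, z)) := by
    intro k
    induction k with
    | zero => exact fun hk => hlevel _ o hbase
    | succ k ih =>
      intro hk
      by_cases hpar : k % 2 = 0
      · obtain ⟨i₀, hi₀⟩ := exists_ne o
        refine hlevel _ i₀ fun z => ?_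
        have := ha (ih (by omega) i₀ z)
        rw [a_apply_inl_of_ne hm _ hi₀] at this
        simpa [pairEven, hpar, hk] using this
      · refine hlevel _ o fun z => ?_
        have := ha (ih (by omega) o z)
        rw [a_apply_inl_of_eq hm (by simp; omega)] at this
        simpa [pairOdd, show k % 2 = 1 by omega, hk] using this
  rcases w with ⟨⟨k, hk⟩, i, z⟩ | z
  · exact hall k hk i z
  · exact hlast z

theorem alternatingGroup_le_G [Nontrivial A] [Nontrivial B]
    (hR : MulAction.IsPretransitive R A) (hS : MulAction.IsPretransitive S B) :
    alternatingGroup (Omega m B ω) ≤ G hm ω o R S := by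
  have : Nontrivial (Omega m B ω) :=
    (Sum.inl_injective.comp (Prod.mk_right_injective (⟨0, by omega⟩ : Fin m))).nontrivial
  exact alternatingGroup_le_of_threeCycleRel fun u v =>
    (threeCycleRel_all hm hR hS u).symm.trans (threeCycleRel_all hm hR hS v)

end Alternating

/-! ### The vertex stabiliser and its action on the neighbours -/

section Stabiliser

variable {m : ℕ} (hm : 3 ≤ m) {A B : Type*} [DecidableEq A] [DecidableEq B] {ω : A} {o : B}
  {R : Subgroup (Perm A)} {S : Subgroup (Perm B)}

theorem aG_mul_aG : aG hm ω o R S * aG hm ω o R S = 1 := Subtype.ext (a_mul_a hm)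

theorem closure_HG_union_aG :
    Subgroup.closure ((HG hm ω o R S : Set (G hm ω o R S)) ∪ {aG hm ω o R S}) = ⊤ := by
  rw [eq_top_iff]
  rintro ⟨g, hg⟩ -
  have hle : G hm ω o R S ≤ (Subgroup.closure
      ((HG hm ω o R S : Set (G hm ω o R S)) ∪ {aG hm ω o R S})).map (G hm ω o R S).subtype := by
    refine sup_le (fun h hh => ?_) ((Subgroup.closure_le _).2 ?_)
    · exact ⟨⟨h, H_le_G hm hh⟩, Subgroup.subset_closure (Or.inl hh), rfl⟩
    · rintro _ rfl
      exact ⟨aG hm ω o R S, Subgroup.subset_closure (Or.inr rfl), rfl⟩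
  obtain ⟨g', hg', rfl⟩ := hle hg
  exact hg'

omit [DecidableEq A] in
theorem exists_apply_inr_of_mem_H [Finite B] {h : Perm (Omega m B ω)} (hh : h ∈ H m ω R S)
    (z : {z : A // z ≠ ω}) : ∃ z', h (Sum.inr z) = Sum.inr z' := by
  obtain ⟨τ, -, f, ρ, rfl⟩ := mem_H_iff.1 hh
  exact ⟨_, rfl⟩

theorem aG_notMem_HG [Finite B] [Nontrivial A] : aG hm ω o R S ∉ HG hm ω o R S := by
  intro h
  obtain ⟨z, hz⟩ := exists_ne ω
  obtain ⟨z', hz'⟩ := exists_apply_inr_of_mem_H (Subgroup.mem_subgroupOf.1 h) ⟨z, hz⟩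
  cases hz'

/-- The group `H` is core-free in `G`: a normal subgroup of `G` inside `H` preserves all
translates of `X_m`, whereas `G` is doubly transitive. -/
theorem eq_one_of_forall_conj_mem_HG [Fintype A] [Fintype B] [Nontrivial A]
    (hΩ : 4 ≤ Nat.card (Omega m B ω)) (hG : alternatingGroup (Omega m B ω) ≤ G hm ω o R S)
    (g : G hm ω o R S) (hg : ∀ k : G hm ω o R S, k⁻¹ * g * k ∈ HG hm ω o R S) : g = 1 := by
  refine Subtype.ext (Equiv.ext fun w => ?_)
  by_contra hw
  obtain ⟨z, hz⟩ := exists_ne ω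
  obtain ⟨c, hc, hcw, hcw'⟩ := exists_mem_alternatingGroup_apply_eq hΩ (Ne.symm hw)
    (Sum.inr_ne_inl : (Sum.inr ⟨z, hz⟩ : Omega m B ω) ≠ Sum.inl (⟨0, by omega⟩, o, z))
  obtain ⟨z', hz'⟩ := exists_apply_inr_of_mem_H
    (Subgroup.mem_subgroupOf.1 (hg (⟨c, hG hc⟩⁻¹))) ⟨z, hz⟩
  have hcw'' : c⁻¹ (Sum.inr ⟨z, hz⟩) = w := by rw [Perm.inv_eq_iff_eq]; exact hcw.symm
  simp only [Subgroup.coe_mul, inv_inv, Subgroup.coe_inv, Perm.mul_apply, hcw''] at hz'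
  rw [hcw'] at hz'
  cases hz'

/-- The homomorphism `ψ` describes the action of `H` on the union of the blocks `Y_{i,0}`,
identified with `B × A`. -/
def IsLevelHom (ψ : HG hm ω o R S →* Perm (B × A)) : Prop :=
  ∀ (h : HG hm ω o R S) (q : B × A),
    (h : Perm (Omega m B ω)) (Sum.inl (⟨0, by omega⟩, q)) = Sum.inl (⟨0, by omega⟩, ψ h q)

variable (ω o R S) in
theorem exists_levelHom [Finite B] : ∃ ψ : HG hm ω o R S →* Perm (B × A), IsLevelHom hm ψ := by
  refine exists_monoidHom_perm (M := HG hm ω o R S) (Ω := Omega m B ω)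
    (ι := fun q : B × A => Sum.inl (⟨0, by omega⟩, q))
    (fun q q' h => by simpa using h) fun h q => ?_
  obtain ⟨τ, -, f, ρ, hh⟩ := mem_H_iff.1 (Subgroup.mem_subgroupOf.1 h.2)
  refine ⟨(τ q.1, (f (⟨0, by omega⟩, q.1) : Perm A) q.2), ?_⟩
  change (h : Perm (Omega m B ω)) _ = _
  rw [hh]
  rfl

variable {hm}

theorem exists_HG_coe_eq [Finite B] {τ : Perm B} (hτ : τ ∈ S) (f : Fin m × B → R)
    (ρ : MulAction.stabilizer R ω) :
    ∃ h : HG hm ω o R S, (h : Perm (Omega m B ω)) = y m ω τ * blockPerm m B ω R (f, ρ) := by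
  have := mem_H_iff.2 ⟨τ, hτ, f, ρ, rfl⟩
  exact ⟨⟨⟨_, H_le_G hm this⟩, this⟩, rfl⟩

theorem exists_coe_HG_eq [Finite B] (h : HG hm ω o R S) : ∃ τ ∈ S, ∃ f ρ,
    (h : Perm (Omega m B ω)) = y m ω τ * blockPerm m B ω R (f, ρ) :=
  mem_H_iff.1 (Subgroup.mem_subgroupOf.1 h.2)

namespace IsLevelHom

variable {ψ : HG hm ω o R S →* Perm (B × A)}

theorem apply_eq (hψ : IsLevelHom hm ψ) {h : HG hm ω o R S} {τ : Perm B} {f : Fin m × B → R}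
    {ρ : MulAction.stabilizer R ω}
    (hh : (h : Perm (Omega m B ω)) = y m ω τ * blockPerm m B ω R (f, ρ)) (i : B) (z : A) :
    ψ h (i, z) = (τ i, (f (⟨0, by omega⟩, i) : Perm A) z) := by
  have := hψ h (i, z)
  rw [hh] at this
  simpa using this.symm

theorem transitive [Finite B] (hψ : IsLevelHom hm ψ) (hR : MulAction.IsPretransitive R A)
    (hS : MulAction.IsPretransitive S B) (q : B × A) : ∃ h, ψ h (o, ω) = q := by
  obtain ⟨τ, hτ⟩ := MulAction.exists_smul_eq S o q.1
  obtain ⟨σ, hσ⟩ := MulAction.exists_smul_eq R ω q.2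
  obtain ⟨h, hh⟩ := exists_HG_coe_eq (hm := hm) (o := o) τ.2 (fun _ => σ)
    (1 : MulAction.stabilizer R ω)
  exact ⟨h, (hψ.apply_eq hh o ω).trans (Prod.ext hτ hσ)⟩

/-- The stabiliser in `H` of the point `ω` of `Y_{o,0}` is `H ∩ aHa`: the involution `a` moves
every other point of the zeroth level out of this level. -/
theorem apply_base_eq_iff [Finite B] (hψ : IsLevelHom hm ψ) (h : HG hm ω o R S) :
    ψ h (o, ω) = (o, ω) ↔
      (aG hm ω o R S)⁻¹ * (h : G hm ω o R S) * aG hm ω o R S ∈ HG hm ω o R S := by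
  have ha' : (aG hm ω o R S)⁻¹ = aG hm ω o R S := inv_eq_of_mul_eq_one_left (aG_mul_aG hm)
  rw [ha']
  constructor
  · intro hbase
    obtain ⟨τ, hτ, f, ρ, hh⟩ := exists_coe_HG_eq h
    rw [hψ.apply_eq hh, Prod.mk.injEq] at hbase
    refine Subgroup.mem_subgroupOf.2 ?_
    have hconj := a_conj hm hbase.1 f ρ hbase.2
    rw [← hh] at hconj
    exact mem_H_iff.2 ⟨τ, hτ, _, _, hconj⟩
  · intro hmem
    set h' : HG hm ω o R S := ⟨_, hmem⟩ with hh'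
    have key := hψ h' (o, ω)
    have hcoe : ((h' : G hm ω o R S) : Perm (Omega m B ω)) = a hm ω o * h * a hm ω o := rfl
    rw [hcoe, Perm.mul_apply, a_apply_base, Perm.mul_apply, hψ h (o, ω)] at key
    generalize ψ h (o, ω) = q at key
    obtain ⟨i, z⟩ := q
    by_cases hi : i = o
    · subst hi
      by_cases hz : z = ω
      · rw [hz]
      · rw [a_apply_inl_zero hm hz] at key
        cases key
    · rw [a_apply_inl_of_ne hm _ hi] at key
      simp [pairEven, show 1 < m by omega] at key

theorem range_eq [Finite B] (hψ : IsLevelHom hm ψ) : ψ.range = imprimitiveWreath R S := by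
  ext p
  constructor
  · rintro ⟨h, rfl⟩
    obtain ⟨τ, hτ, f, ρ, hh⟩ := exists_coe_HG_eq h
    exact ⟨τ, hτ, fun i => f (⟨0, by omega⟩, i), hψ.apply_eq hh⟩
  · rintro ⟨τ, hτ, f, hp⟩
    obtain ⟨h, hh⟩ := exists_HG_coe_eq (hm := hm) (o := o) hτ (fun q => f q.2)
      (1 : MulAction.stabilizer R ω)
    exact ⟨h, Equiv.ext fun ⟨i, z⟩ => (hψ.apply_eq hh i z).trans (hp i z).symm⟩

theorem exists_ker_iff [Finite B] [Nonempty A] (hψ : IsLevelHom hm ψ) (g : G hm ω o R S) :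
    (∃ h : HG hm ω o R S, ψ h = 1 ∧ g = h) ↔
      ∃ f ρ, (∀ i, f (⟨0, by omega⟩, i) = 1) ∧
        (g : Perm (Omega m B ω)) = blockPerm m B ω R (f, ρ) := by
  constructor
  · rintro ⟨h, hker, rfl⟩
    obtain ⟨τ, hτ, f, ρ, hh⟩ := exists_coe_HG_eq h
    have hfix : ∀ i z, τ i = i ∧ (f (⟨0, by omega⟩, i) : Perm A) z = z := by
      intro i z
      have := hψ.apply_eq hh i z
      rw [hker] at this
      simpa [eq_comm] using this
    have hτ1 : τ = 1 := Equiv.ext fun i => (hfix i (Classical.arbitrary A)).1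
    refine ⟨f, ρ, fun i => Subtype.ext (Equiv.ext fun z => (hfix i z).2), ?_⟩
    rw [hh, hτ1, y_one, one_mul]
  · rintro ⟨f, ρ, hf, hg⟩
    obtain ⟨h, hh⟩ := exists_HG_coe_eq (hm := hm) (o := o) S.one_mem f ρ
    refine ⟨h, Equiv.ext fun ⟨i, z⟩ => ?_, Subtype.ext ?_⟩
    · rw [hψ.apply_eq hh, hf]
      rfl
    · rw [hg, hh, y_one, one_mul]

/-- Elements of `H` fixing the zeroth level pointwise, whose conjugates under `a` have the same
property: besides `Y_{i,0}` for all `i`, they fix `X_m` and `Y_{i,1}` for `i ≠ o` pointwise. -/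
theorem exists_ker_conj_iff [Finite B] [Nonempty A] (hψ : IsLevelHom hm ψ) (g : G hm ω o R S) :
    ((∃ h : HG hm ω o R S, ψ h = 1 ∧ g = h) ∧
      ∃ h : HG hm ω o R S, ψ h = 1 ∧ (aG hm ω o R S)⁻¹ * g * aG hm ω o R S = h) ↔
      ∃ f, (∀ i, f (⟨0, by omega⟩, i) = 1) ∧ (∀ i, i ≠ o → f (⟨1, by omega⟩, i) = 1) ∧
        (g : Perm (Omega m B ω)) = blockPerm m B ω R (f, 1) := by
  have ha' : (aG hm ω o R S)⁻¹ = aG hm ω o R S := inv_eq_of_mul_eq_one_left (aG_mul_aG hm)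
  have hpair : ∀ h0 : 0 < m, pairEven (⟨0, h0⟩ : Fin m) = ⟨1, by omega⟩ := fun h0 => by
    simp [pairEven, show 1 < m by omega]
  rw [ha', hψ.exists_ker_iff, hψ.exists_ker_iff]
  have hconj : ∀ (f : Fin m × B → R) (ρ : MulAction.stabilizer R ω)
      (hf : f (⟨0, by omega⟩, o) = 1),
      a hm ω o * blockPerm m B ω R (f, ρ) * a hm ω o = blockPerm m B ω R
        (fun q => if q = (⟨0, by omega⟩, o) then (ρ : R) else f (partner o q),
          ⟨f (⟨0, by omega⟩, o), by rw [hf]; exact Subgroup.one_mem _⟩) := by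
    intro f ρ hf
    have := a_conj hm (τ := 1) (o := o) rfl f ρ (by rw [hf]; exact Subgroup.one_mem _)
    rwa [y_one, one_mul, one_mul] at this
  constructor
  · rintro ⟨⟨f, ρ, hf, hg⟩, f', ρ', hf', hg'⟩
    change a hm ω o * (g : Perm (Omega m B ω)) * a hm ω o = _ at hg'
    rw [hg, hconj f ρ (hf o)] at hg'
    have he := congrArg Prod.fst (blockPerm_injective hg')
    have hρ : ρ = 1 := by
      have := (congrFun he (⟨0, by omega⟩, o)).trans (hf' o)
      exact Subtype.ext (by simpa using this)
    refine ⟨f, hf, fun i hi => ?_, by rw [hg, hρ]⟩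
    have := (congrFun he (⟨0, by omega⟩, i)).trans (hf' i)
    simpa [hi, partner, hpair] using this
  · rintro ⟨f, hf, hf1, hg⟩
    refine ⟨⟨f, 1, hf, hg⟩, ?_⟩
    have h := hconj f 1 (hf o)
    rw [← hg] at h
    refine ⟨_, _, fun i => ?_, h⟩
    by_cases hi : i = o
    · simp [hi]
    · simp [hi, partner, hpair, hf1 i hi]

end IsLevelHom

end Stabiliser

/-! ### The kernels of the balls of radius one -/

section Kernels

variable {m : ℕ} {A B : Type*} [Fintype B]

/-- An enumeration of the blocks of positive level, which give the factors of `G_u^{[1]}`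
isomorphic to `R`. -/
theorem exists_enumeration_pos_level (hm : 3 ≤ m) :
    ∃ e : Fin (Fintype.card B * (m - 1)) → Fin m × B, Function.Injective e ∧
      ∀ q : Fin m × B, q.1 ≠ ⟨0, by omega⟩ ↔ ∃ k, e k = q := by
  obtain ⟨e, he, h⟩ := Finset.exists_fin_enumeration
    ((Finset.univ.erase (⟨0, by omega⟩ : Fin m)) ×ˢ (Finset.univ : Finset B))
    (n := Fintype.card B * (m - 1)) (by simp [mul_comm])
  exact ⟨e, he, fun q => by rw [← h]; simp⟩

/-- An enumeration of the block `Y_{o,1}` and the blocks of level at least two, which give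
the factors of `G_{u,v}^{[1]}`. -/
theorem exists_enumeration_free_blocks [DecidableEq B] (hm : 3 ≤ m) (o : B) :
    ∃ e : Fin (Fintype.card B * (m - 2) + 1) → Fin m × B, Function.Injective e ∧
      ∀ q : Fin m × B, (q.1 ≠ ⟨0, by omega⟩ ∧ (q.1 = ⟨1, by omega⟩ → q.2 = o)) ↔
        ∃ k, e k = q := by
  have h01 : (⟨1, by omega⟩ : Fin m) ≠ ⟨0, by omega⟩ := by simp
  obtain ⟨e, he, h⟩ := Finset.exists_fin_enumeration
    (insert (⟨1, by omega⟩, o) (((Finset.univ.erase (⟨0, by omega⟩ : Fin m)).erase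
      ⟨1, by omega⟩) ×ˢ (Finset.univ : Finset B)))
    (n := Fintype.card B * (m - 2) + 1) (by
      rw [Finset.card_insert_of_notMem (by simp), Finset.card_product,
        Finset.card_erase_of_mem (by simp), Finset.card_erase_of_mem (by simp)]
      simp [mul_comm, Nat.sub_sub])
  refine ⟨e, he, fun q => ?_⟩
  rw [← h]
  obtain ⟨j, i⟩ := q
  by_cases hj : j = ⟨1, by omega⟩ <;> simp [hj]

variable {hm : 3 ≤ m} [DecidableEq A] [Nontrivial A] [DecidableEq B] {ω : A} {o : B}
  {R : Subgroup (Perm A)} {S : Subgroup (Perm B)} {ψ : HG hm ω o R S →* Perm (B × A)}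

theorem nonempty_ballKernel_mulEquiv (hψ : IsLevelHom hm ψ)
    (hR : MulAction.IsPretransitive R A) (hS : MulAction.IsPretransitive S B)
    (u : G hm ω o R S ⧸ HG hm ω o R S) :
    Nonempty (ballKernel (G hm ω o R S) (graph hm ω o R S) 1 u ≃*
      (Fin (Fintype.card B * (m - 1)) → R) × MulAction.stabilizer R ω) := by
  obtain ⟨k, rfl⟩ := QuotientGroup.mk_surjective u
  obtain ⟨e, he, hP⟩ := exists_enumeration_pos_level (B := B) hm
  have hmem := mem_ballKernel_one_iff (aG_mul_aG hm) (aG_notMem_HG hm) (hψ.transitive hR hS)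
    hψ.apply_base_eq_iff k
  let φ : (Fin (Fintype.card B * (m - 1)) → R) × MulAction.stabilizer R ω →* G hm ω o R S :=
    ((blockPerm m B ω R).codRestrict (G hm ω o R S)
      fun p => H_le_G hm (blockPerm_mem_H p)).comp
      ((Function.ExtendByOne.hom R e).prodMap (MonoidHom.id _))
  refine nonempty_mulEquiv_of_forall_mem_iff ((MulAut.conj k).toMonoidHom.comp φ) ?_ _ fun g => ?_
  · refine (MulAut.conj k).injective.comp ?_
    intro p p' h
    have := blockPerm_injective (congrArg Subtype.val h)
    exact Prod.ext (extendByOne_injective he (congrArg Prod.fst this))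
      (congrArg (fun p => p.2) this)
  · refine (hmem g).trans ((hψ.exists_ker_iff _).trans ?_)
    constructor
    · rintro ⟨f, ρ, hf, hg⟩
      obtain ⟨f', rfl⟩ := (exists_extendByOne_eq_iff he hP f).2 fun q hq => by
        rw [not_not] at hq
        have := hf q.2
        rwa [← hq] at this
      refine ⟨(f', ρ), ?_⟩
      have : φ (f', ρ) = k⁻¹ * g * k := Subtype.ext hg.symm
      change k * φ (f', ρ) * k⁻¹ = g
      rw [this]
      group
    · rintro ⟨⟨f', ρ⟩, rfl⟩
      refine ⟨_, ρ, fun i => (exists_extendByOne_eq_iff he hP _).1 ⟨f', rfl⟩ _ (by simp), ?_⟩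
      change ((k⁻¹ * (k * φ (f', ρ) * k⁻¹) * k : G hm ω o R S) : Perm (Omega m B ω)) =
        (φ (f', ρ) : Perm (Omega m B ω))
      congr 1
      group

theorem nonempty_arcKernel_mulEquiv (hψ : IsLevelHom hm ψ)
    (hR : MulAction.IsPretransitive R A) (hS : MulAction.IsPretransitive S B)
    {u v : G hm ω o R S ⧸ HG hm ω o R S} (huv : (graph hm ω o R S).Adj u v) :
    Nonempty (arcKernel (G hm ω o R S) (graph hm ω o R S) u v ≃*
      (Fin (Fintype.card B * (m - 2) + 1) → R)) := by
  obtain ⟨k, rfl, rfl⟩ := cosetGraph_exists_of_adj (aG_mul_aG hm) (aG_notMem_HG hm) huv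
  obtain ⟨e, he, hP⟩ := exists_enumeration_free_blocks hm o
  have hmem := mem_arcKernel_iff (aG_mul_aG hm) (aG_notMem_HG hm) (hψ.transitive hR hS)
    hψ.apply_base_eq_iff k
  let φ : (Fin (Fintype.card B * (m - 2) + 1) → R) →* G hm ω o R S :=
    ((blockPerm m B ω R).codRestrict (G hm ω o R S)
      fun p => H_le_G hm (blockPerm_mem_H p)).comp
      ((MonoidHom.inl _ _).comp (Function.ExtendByOne.hom R e))
  refine nonempty_mulEquiv_of_forall_mem_iff ((MulAut.conj k).toMonoidHom.comp φ) ?_ _ fun g => ?_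
  · refine (MulAut.conj k).injective.comp ?_
    intro p p' h
    have := blockPerm_injective (congrArg Subtype.val h)
    exact extendByOne_injective he (congrArg Prod.fst this)
  · refine (hmem g).trans ((hψ.exists_ker_conj_iff _).trans ?_)
    constructor
    · rintro ⟨f, hf, hf1, hg⟩
      obtain ⟨f', rfl⟩ := (exists_extendByOne_eq_iff he hP f).2 fun q hq => by
        obtain ⟨j, i⟩ := q
        by_cases hj : j = ⟨0, by omega⟩
        · rw [hj]
          exact hf i
        · simp only [ne_eq, hj, not_false_eq_true, true_and, Classical.not_imp] at hq
          rw [hq.1]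
          exact hf1 i hq.2
      refine ⟨f', ?_⟩
      have : φ f' = k⁻¹ * g * k := Subtype.ext hg.symm
      change k * φ f' * k⁻¹ = g
      rw [this]
      group
    · rintro ⟨f', rfl⟩
      refine ⟨_, fun i => (exists_extendByOne_eq_iff he hP _).1 ⟨f', rfl⟩ _ (by simp),
        fun i hi => (exists_extendByOne_eq_iff he hP _).1 ⟨f', rfl⟩ _ (by simp [hi]), ?_⟩
      change ((k⁻¹ * (k * φ f' * k⁻¹) * k : G hm ω o R S) : Perm (Omega m B ω)) =
        (φ f' : Perm (Omega m B ω))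
      congr 1
      group

end Kernels

theorem five_le_card_Omega {m : ℕ} (hm : 3 ≤ m) {A B : Type*} [Fintype A] [Fintype B]
    [DecidableEq A] [Nontrivial A] [Nontrivial B] (ω : A) : 5 ≤ Nat.card (Omega m B ω) := by
  have hA : 1 < Fintype.card A := Fintype.one_lt_card
  have hB : 1 < Fintype.card B := Fintype.one_lt_card
  have h4 : 2 * 2 ≤ Fintype.card B * Fintype.card A := Nat.mul_le_mul hB hA
  have : 3 * (2 * 2) ≤ m * (Fintype.card B * Fintype.card A) := Nat.mul_le_mul hm h4
  rw [Nat.card_eq_fintype_card, Fintype.card_sum, Fintype.card_prod, Fintype.card_prod,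
    Fintype.card_fin]
  omega

end SpigaGraph

theorem theorem1p3 {A B : Type*} [Fintype A] [DecidableEq A] [Fintype B] [DecidableEq B]
    (r s : ℕ) (hr : 1 < r) (hs : 1 < s) (hA : Fintype.card A = r) (hB : Fintype.card B = s)
    (R : Subgroup (Equiv.Perm A)) (S : Subgroup (Equiv.Perm B))
    (hR : MulAction.IsPretransitive R A) (hS : MulAction.IsPretransitive S B)
    (ω : A) (o : B) :
    (∀ (m : ℕ) (hm : 3 ≤ m), Odd m →
      alternatingGroup (SpigaGraph.Omega m B ω) ≤ SpigaGraph.G hm ω o R S ∧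
      IsAlmostSimple (SpigaGraph.G hm ω o R S) ∧
      (∀ u v, (SpigaGraph.graph hm ω o R S).Adj u v ↔ (SpigaGraph.cos hm ω o R S).Adj u v) ∧
      (SpigaGraph.graph hm ω o R S).Connected ∧
      IsArcTransitive (SpigaGraph.G hm ω o R S) (SpigaGraph.graph hm ω o R S) ∧
      (∀ u, ((SpigaGraph.graph hm ω o R S).neighborSet u).ncard = r * s) ∧
      ∀ u v, (SpigaGraph.graph hm ω o R S).Adj u v →
        PermIsomorphic
          (localAction (SpigaGraph.G hm ω o R S) (SpigaGraph.graph hm ω o R S) u)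
          (imprimitiveWreath R S) ∧
        Nonempty
          (ballKernel (SpigaGraph.G hm ω o R S) (SpigaGraph.graph hm ω o R S) 1 u ≃*
            (Fin (s * (m - 1)) → R) × MulAction.stabilizer R ω) ∧
        Nonempty
          (arcKernel (SpigaGraph.G hm ω o R S) (SpigaGraph.graph hm ω o R S) u v ≃*
            (Fin (s * (m - 2) + 1) → R))) ∧
    (∀ N : ℕ, ∃ (m : ℕ) (hm : 3 ≤ m), Odd m ∧
      ∀ u v, (SpigaGraph.graph hm ω o R S).Adj u v →
        N < Nat.card
          (arcKernel (SpigaGraph.G hm ω o R S) (SpigaGraph.graph hm ω o R S) u v)) := by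
  have : Nontrivial A := Fintype.one_lt_card_iff_nontrivial.1 (by omega)
  have : Nontrivial B := Fintype.one_lt_card_iff_nontrivial.1 (by omega)
  subst hA hB
  refine ⟨fun m hm _ => ?_, fun N => ?_⟩
  · have hG := SpigaGraph.alternatingGroup_le_G hm (ω := ω) (o := o) hR hS
    have hΩ := SpigaGraph.five_le_card_Omega (B := B) hm ω
    have haa := SpigaGraph.aG_mul_aG hm (ω := ω) (o := o) (R := R) (S := S)
    have haH := SpigaGraph.aG_notMem_HG hm (ω := ω) (o := o) (R := R) (S := S)
    obtain ⟨ψ, hψ⟩ := SpigaGraph.exists_levelHom hm ω o R S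
    have hlocal := cosetGraph_local haa haH (hψ.transitive hR hS) hψ.apply_base_eq_iff
    refine ⟨hG, isAlmostSimple_of_alternatingGroup_le hΩ hG, cosetGraph_adj haa haH,
      cosetGraph_connected haa haH (SpigaGraph.closure_HG_union_aG hm),
      cosetGraph_isArcTransitive haa haH
        (SpigaGraph.eq_one_of_forall_conj_mem_HG hm (by omega) hG), fun u => ?_,
      fun u v huv => ⟨?_, SpigaGraph.nonempty_ballKernel_mulEquiv hψ hR hS u,
        SpigaGraph.nonempty_arcKernel_mulEquiv hψ hR hS huv⟩⟩
    · refine (hlocal u).1.trans ?_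
      rw [Nat.card_prod, Nat.card_eq_fintype_card, Nat.card_eq_fintype_card, mul_comm]
    · rw [← hψ.range_eq]
      exact (hlocal u).2
  -- Any odd `m > N` would do, since the group has order at least `2 ^ (s * (m - 2) + 1)`.
  · refine ⟨2 * N + 3, by omega, ⟨N + 1, by ring⟩, fun u v huv => ?_⟩
    obtain ⟨ψ, hψ⟩ := SpigaGraph.exists_levelHom (m := 2 * N + 3) (by omega) ω o R S
    obtain ⟨e⟩ := SpigaGraph.nonempty_arcKernel_mulEquiv hψ hR hS huv
    have : Nontrivial R := by
      obtain ⟨z, hz⟩ := exists_ne ω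
      obtain ⟨σ, hσ⟩ := MulAction.exists_smul_eq R ω z
      exact ⟨σ, 1, fun h => hz (by rw [← hσ, h, one_smul])⟩
    rw [Nat.card_congr e.toEquiv, Nat.card_fun, Nat.card_fin]
    have hN : N ≤ Fintype.card B * (2 * N + 3 - 2) + 1 := by
      have := Nat.mul_le_mul hs.le (le_refl (2 * N + 3 - 2))
      omega
    exact hN.trans_lt (Nat.lt_pow_self Finite.one_lt_card)
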